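/- Let $G$ be a finite graph without loops, in which multiple edges are allowed. Given an orientation of $G$, an abelian group $A$ and a function $f:E(G)\to A$, let $$\partial f(v)=\sum_{e\text{ directed away from }v} f(e)-\sum_{e\text{ directed towards }v} f(e)\qquad (v\in V(G)).$$ The graph $G$ is called $\mathbb{Z}_3$-connected if, with respect to an orientation of $G$ (equivalently, every orientation of $G$), for every function $b:V(G)\to\mathbb{Z}_3$ with $\sum_{v\in V(G)} b(v)=0$ there is a function $f:E(G)\to\mathbb{Z}_3\setminus\{0\}$ with $\partial f=b$. It admits a nowhere-zero $3$-flow if, for some orientation of $G$, there is a function $f:E(G)\to\{\pm1,\pm2\}\subset\mathbb{Z}$ with $\partial f(v)=0$ (in $\mathbb{Z}$) for every $v\in V(G)$. **Corollary.** If $G$ contains $4$ pairwise edge-disjoint spanning trees, then $G$ is $\mathbb{Z}_3$-connected and admits a nowhere-zero $3$-flow. -/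

import Mathlib

namespace Graph

variable {α β : Type*}

/-- A graph is connected if it has a vertex and any two of its vertices are joined by a walk. -/
def IsConnected (G : Graph α β) : Prop :=
  V(G).Nonempty ∧ ∀ x ∈ V(G), ∀ y ∈ V(G), Relation.ReflTransGen G.Adj x y

/-- `G` has a cycle of length `n`: distinct vertices `x 0, …, x (n - 1)` and distinct edges
`e 0, …, e (n - 1)` such that `e i` joins `x i` and `x (i + 1)`, with indices taken modulo `n`.
A cycle of length one is a loop and a cycle of length two is a pair of parallel edges. -/
def HasCycleOfLength (G : Graph α β) (n : ℕ) [NeZero n] : Prop :=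
  ∃ (x : Fin n → α) (e : Fin n → β), Function.Injective x ∧ Function.Injective e ∧
    ∀ i, G.IsLink (e i) (x i) (x (i + 1))

/-- A tree is a connected graph without cycles. -/
def IsTree (G : Graph α β) : Prop :=
  G.IsConnected ∧ ∀ (n : ℕ) [NeZero n], ¬ G.HasCycleOfLength n

/-- `G` contains `m` pairwise edge-disjoint spanning trees. -/
def HasEdgeDisjointSpanningTrees (G : Graph α β) (m : ℕ) : Prop :=
  ∃ T : Fin m → Graph α β, (∀ i, (T i).IsSpanningSubgraph G ∧ (T i).IsTree) ∧
    ∀ i j, i ≠ j → Disjoint E(T i) E(T j)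

/-- An orientation of `G` directs every edge of `G` from one of its ends, its tail, to the other
one, its head. -/
structure Orientation (G : Graph α β) where
  /-- The tail of an edge. -/
  tail : E(G) → V(G)
  /-- The head of an edge. -/
  head : E(G) → V(G)
  isLink : ∀ e : E(G), G.IsLink e (tail e) (head e)

/-- Every graph has an orientation. -/
theorem nonempty_orientation (G : Graph α β) : Nonempty G.Orientation := by
  choose x y h using fun e : E(G) => G.exists_isLink_of_mem_edgeSet e.2
  exact ⟨⟨fun e => ⟨x e, (h e).left_mem⟩, fun e => ⟨y e, (h e).right_mem⟩, h⟩⟩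

/-- The boundary of `f : E(G) → A` at the vertex `v`: the sum of `f` over the edges directed away
from `v` minus the sum of `f` over the edges directed towards `v`. It is used for graphs with
finitely many edges only. -/
noncomputable def Orientation.boundary {G : Graph α β} {A : Type*} [AddCommGroup A]
    (D : G.Orientation) (f : E(G) → A) (v : V(G)) : A :=
  (∑ᶠ (e : E(G)) (_ : D.tail e = v), f e) - ∑ᶠ (e : E(G)) (_ : D.head e = v), f e

/-- A finite graph `G` is `A`-connected if, with respect to every orientation of `G`, every
function `b : V(G) → A` whose values sum to zero is the boundary of a function that assigns a
nonzero element of `A` to each edge. Reversing an edge and negating its value does not change the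
boundary, so it makes no difference which orientation is taken. -/
def IsGroupConnected (G : Graph α β) (A : Type*) [AddCommGroup A] : Prop :=
  ∀ (D : G.Orientation) (b : V(G) → A), ∑ᶠ v, b v = 0 →
    ∃ f : E(G) → A, (∀ e, f e ≠ 0) ∧ ∀ v, D.boundary f v = b v

/-- A finite graph admits a nowhere-zero `k`-flow if, for some orientation, the integers
`±1, …, ±(k - 1)` can be assigned to its edges such that the boundary is zero at every vertex. -/
def HasNowhereZeroFlow (G : Graph α β) (k : ℕ) : Prop :=
  ∃ (D : G.Orientation) (f : E(G) → ℤ), (∀ e, f e ≠ 0 ∧ |f e| < k) ∧ ∀ v, D.boundary f v = 0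

end Graph

/-! The nonzero elements of the field with three elements are ±1, so a nowhere-zero function on the
edges is a choice of orientation, and the task is to orient the edges with prescribed boundary
modulo 3. The parity of the boundary at a vertex is forced by its degree, so it may as well be
prescribed modulo 6. For a set of vertices with total demand `a`, `norm6 a` is the least net number
of edges that must leave or enter it.

The first ingredient is an extension theorem, `Admissible.solvable`. One additional vertex has all
its edges already oriented; `w` and `s` record how many of them each vertex receives and their net
direction. If the additional vertex has degree at most 4 plus the norm of its net flow, and every
nonempty proper subset of `S` has degree at least 4 plus the norm of its demand, then the rest can
be oriented. A minimal counterexample has no tight set with two or more vertices: one could contract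
it, orient, then turn its complement into the additional vertex. All these sets then have slack two
by parity. This permits lifting a pair of edges at a vertex with slack or with demand zero, and
orienting an edge that helps both its ends. What remains is a graph whose demands all have one sign,
and there an edge of the additional vertex is deleted or doubled and reversed. With no additional
edges, the theorem applies whenever all cuts have at least six edges.

The second ingredient, `solvable_of_packing`, handles small cuts. Four disjoint connected spanning
classes meet a cut of at most five edges in 1, 1, 1 and at most 2 edges. One side is then connected
in every class (`Connects.inside_or_inside`), and induction proceeds by contracting it, or, if it is
a single vertex, by contracting the rest or lifting the two edges there.

Finally `exists_integer_flow` turns a modulo 3 flow into an integer flow by Hall's theorem. -/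

namespace EdgeMultiset

open scoped Pointwise

variable {V : Type*}

/-! ### Residues modulo six -/

/-- The distance from `a` to zero in the cyclic group of order six. -/
def norm6 (a : ZMod 6) : ℕ := min a.val (-a).val

/-- Reduction modulo two. -/
def parity : ZMod 6 →+* ZMod 2 := ZMod.castHom (by norm_num) (ZMod 2)

theorem norm6_zero : norm6 0 = 0 := by decide

theorem norm6_eq_zero {a : ZMod 6} : norm6 a = 0 ↔ a = 0 := by
  revert a; decide

theorem norm6_neg (a : ZMod 6) : norm6 (-a) = norm6 a := by
  revert a; decide

theorem norm6_le_three (a : ZMod 6) : norm6 a ≤ 3 := by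
  revert a; decide

theorem norm6_add_le (a b : ZMod 6) : norm6 (a + b) ≤ norm6 a + norm6 b := by
  revert a b; decide

theorem norm6_sub_le (a b : ZMod 6) : norm6 (a - b) ≤ norm6 a + norm6 b := by
  revert a b; decide

theorem parity_norm6 (a : ZMod 6) : ((norm6 a : ℕ) : ZMod 2) = parity a := by
  revert a; decide

theorem norm6_sum_le (A : Finset V) (f : V → ZMod 6) :
    norm6 (∑ v ∈ A, f v) ≤ ∑ v ∈ A, norm6 (f v) :=
  Finset.le_sum_of_subadditive norm6 norm6_zero.le norm6_add_le A f

theorem even_norm6_add {a : ZMod 6} {n : ℕ} (h : parity a = n) : Even (norm6 a + n) := by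
  rw [← parity_norm6] at h
  rw [← ZMod.natCast_eq_zero_iff_even, Nat.cast_add, h]
  exact CharTwo.add_self_eq_zero _

/-! ### Cuts of multisets of edges -/

/-- The edge `e` has exactly one end in `A`. -/
def Crosses (A : Finset V) (e : Sym2 V) : Prop := ∃ x y, x ∈ A ∧ y ∉ A ∧ e = s(x, y)

theorem crosses_mk {A : Finset V} {x y : V} : Crosses A s(x, y) ↔ ¬(x ∈ A ↔ y ∈ A) := by
  constructor
  · rintro ⟨a, b, ha, hb, h⟩
    rcases Sym2.eq_iff.1 h with ⟨rfl, rfl⟩ | ⟨rfl, rfl⟩ <;> tauto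
  · intro h
    by_cases hx : x ∈ A
    · exact ⟨x, y, hx, by tauto, rfl⟩
    · exact ⟨y, x, by tauto, hx, Sym2.eq_swap⟩

open Classical in
/-- The number of edges of `H` with exactly one end in `A`. -/
noncomputable def cut (H : Multiset (Sym2 V)) (A : Finset V) : ℕ := H.countP (Crosses A)

@[simp] theorem cut_zero (A : Finset V) : cut 0 A = 0 := by simp [cut]

theorem cut_add (H K : Multiset (Sym2 V)) (A : Finset V) : cut (H + K) A = cut H A + cut K A := by
  simp [cut]

open Classical in
theorem cut_cons (x y : V) (H : Multiset (Sym2 V)) (A : Finset V) :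
    cut (s(x, y) ::ₘ H) A = cut H A + if (x ∈ A ↔ y ∈ A) then 0 else 1 := by
  rw [cut, Multiset.countP_cons, cut]
  simp only [crosses_mk, ite_not]

theorem cut_eq_zero {H : Multiset (Sym2 V)} {A : Finset V} (h : ∀ e ∈ H, ¬Crosses A e) :
    cut H A = 0 := by
  classical
  rw [cut, Multiset.countP_eq_zero]
  exact h

theorem exists_crosses_of_cut_pos {H : Multiset (Sym2 V)} {A : Finset V} (h : 0 < cut H A) :
    ∃ e ∈ H, Crosses A e := by
  classical
  exact Multiset.countP_pos.1 h

theorem cut_pos {H : Multiset (Sym2 V)} {A : Finset V} {e : Sym2 V} (he : e ∈ H)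
    (h : Crosses A e) : 0 < cut H A := by
  classical
  exact Multiset.countP_pos.2 ⟨e, he, h⟩

theorem cut_le_card (H : Multiset (Sym2 V)) (A : Finset V) : cut H A ≤ H.card := by
  classical
  exact Multiset.countP_le_card _ _

theorem exists_cons_of_cut_singleton_pos {H : Multiset (Sym2 V)} {v : V} (h : 0 < cut H {v}) :
    ∃ x, x ≠ v ∧ ∃ K, H = s(v, x) ::ₘ K := by
  obtain ⟨e, he, x, y, hx, hy, rfl⟩ := exists_crosses_of_cut_pos h
  obtain ⟨K, rfl⟩ := Multiset.exists_cons_of_mem he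
  simp only [Finset.mem_singleton] at hx hy
  subst hx
  exact ⟨y, hy, K, rfl⟩

/-- Cuts of a contraction are cuts of the graph. Edges that become loops stay in the multiset but
cross nothing. -/
theorem cut_map [DecidableEq V] {H : Multiset (Sym2 V)} {S A : Finset V} (p : V → V)
    (hH : ∀ e ∈ H, ∀ v ∈ e, v ∈ S) :
    cut (H.map (Sym2.map p)) A = cut H (S.filter (p · ∈ A)) := by
  classical
  rw [cut, Multiset.countP_map, cut, Multiset.countP_eq_card_filter]
  congr 1
  refine Multiset.filter_congr fun e he => ?_
  induction e with | _ x y =>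
  have h1 := hH _ he x (Sym2.mem_mk_left x y)
  have h2 := hH _ he y (Sym2.mem_mk_right x y)
  simp [crosses_mk, h1, h2]

-- Handshake argument: an edge with both ends in `A` is counted twice by the degrees, hence not at
-- all modulo 2.
open Classical in
theorem parity_cut (H : Multiset (Sym2 V)) (A : Finset V) :
    (cut H A : ZMod 2) = ∑ v ∈ A, (cut H {v} : ZMod 2) := by
  induction H using Multiset.induction with
  | empty => simp
  | cons e H ih =>
    induction e with | _ x y =>
    simp only [cut_cons, Nat.cast_add, ih, Finset.sum_add_distrib, Finset.mem_singleton]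
    congr 1
    have h : ∀ v, (((if (x = v ↔ y = v) then 0 else 1 : ℕ)) : ZMod 2) =
        (if x = v then 1 else 0) + if y = v then 1 else 0 := by
      intro v
      by_cases hx : x = v <;> by_cases hy : y = v <;> simp [hx, hy]
      decide
    simp only [h, Finset.sum_add_distrib, Finset.sum_ite_eq]
    by_cases hx : x ∈ A <;> by_cases hy : y ∈ A <;> simp [hx, hy]
    decide

/-- If no edge of `H` has both ends in `A`, then the cut of `A` is the sum of the degrees in `A`. -/
theorem cut_eq_sum {H : Multiset (Sym2 V)} {A : Finset V}
    (h : ∀ e ∈ H, ¬∀ v ∈ e, v ∈ A) : cut H A = ∑ v ∈ A, cut H {v} := by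
  classical
  induction H using Multiset.induction with
  | empty => simp
  | cons e H ih =>
    have ih' := ih fun e he => h e (Multiset.mem_cons_of_mem he)
    have hA := h e (Multiset.mem_cons_self e H)
    induction e with | _ x y =>
    simp only [Sym2.ball] at hA
    simp only [cut_cons, ih', Finset.sum_add_distrib, Finset.mem_singleton]
    congr 1
    have h : ∀ v ∈ A, (if (x = v ↔ y = v) then 0 else 1 : ℕ) =
        (if x = v then 1 else 0) + if y = v then 1 else 0 := by
      intro v hv
      by_cases hx : x = v <;> by_cases hy : y = v <;> simp [hx, hy]
      subst hx; subst hy; exact hA ⟨hv, hv⟩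
    rw [Finset.sum_congr rfl h]
    simp only [Finset.sum_add_distrib, Finset.sum_ite_eq]
    by_cases hx : x ∈ A <;> by_cases hy : y ∈ A <;> simp [hx, hy]
    exact hA ⟨hx, hy⟩

variable [DecidableEq V]

/-! ### Boundaries of orientations modulo six -/

/-- The boundaries of the two orientations of an edge. -/
def edgeBoundary (e : Sym2 V) : Set (V → ZMod 6) :=
  {g | ∃ x y, e = s(x, y) ∧ g = Pi.single x 1 - Pi.single y 1}

theorem mem_edgeBoundary {x y : V} {g : V → ZMod 6} : g ∈ edgeBoundary s(x, y) ↔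
    g = Pi.single x 1 - Pi.single y 1 ∨ g = Pi.single y 1 - Pi.single x 1 := by
  constructor
  · rintro ⟨a, b, h, rfl⟩
    rcases Sym2.eq_iff.1 h with ⟨rfl, rfl⟩ | ⟨rfl, rfl⟩ <;> simp
  · rintro (rfl | rfl)
    · exact ⟨x, y, rfl, rfl⟩
    · exact ⟨y, x, Sym2.eq_swap, rfl⟩

/-- The boundaries of the orientations of `H`, reduced modulo six. -/
def reach (H : Multiset (Sym2 V)) : Set (V → ZMod 6) := (H.map edgeBoundary).sum

@[simp] theorem reach_zero : reach (0 : Multiset (Sym2 V)) = 0 := by simp [reach]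

theorem reach_add (H K : Multiset (Sym2 V)) : reach (H + K) = reach H + reach K := by
  simp [reach]

theorem reach_cons (e : Sym2 V) (H : Multiset (Sym2 V)) :
    reach (e ::ₘ H) = edgeBoundary e + reach H := by
  simp [reach]

theorem mem_reach_cons {x y : V} {H : Multiset (Sym2 V)} {f : V → ZMod 6} (hf : f ∈ reach H) :
    f + (Pi.single x 1 - Pi.single y 1) ∈ reach (s(x, y) ::ₘ H) := by
  rw [reach_cons, add_comm f]
  exact Set.add_mem_add ⟨x, y, rfl, rfl⟩ hf

theorem reach_cons_cases {x y : V} {H : Multiset (Sym2 V)} {f : V → ZMod 6}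
    (hf : f ∈ reach (s(x, y) ::ₘ H)) :
    f - (Pi.single x 1 - Pi.single y 1) ∈ reach H ∨ f + (Pi.single x 1 - Pi.single y 1) ∈ reach H := by
  rw [reach_cons] at hf
  obtain ⟨g, hg, k, hk, rfl⟩ := Set.mem_add.1 hf
  rcases mem_edgeBoundary.1 hg with rfl | rfl
  · left; simpa using hk
  · right; convert hk using 1; abel

theorem neg_mem_reach {H : Multiset (Sym2 V)} {f : V → ZMod 6} (hf : f ∈ reach H) :
    -f ∈ reach H := by
  induction H using Multiset.induction generalizing f with
  | empty => simpa using hf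
  | cons e H ih =>
    induction e with | _ x y =>
    rcases reach_cons_cases hf with h | h
    · have := mem_reach_cons (x := y) (y := x) (ih h)
      rw [Sym2.eq_swap]; convert this using 1; abel
    · have := mem_reach_cons (x := x) (y := y) (ih h)
      convert this using 1; abel

/-- Two edges `vx` and `vy` may be replaced by the edge `xy`. -/
theorem reach_lift {v x y : V} {H : Multiset (Sym2 V)} {f : V → ZMod 6}
    (hf : f ∈ reach (s(x, y) ::ₘ H)) : f ∈ reach (s(v, x) ::ₘ s(v, y) ::ₘ H) := by
  rcases reach_cons_cases hf with h | h
  · have := mem_reach_cons (x := x) (y := v) (mem_reach_cons (x := v) (y := y) h)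
    rw [Sym2.eq_swap (a := x)] at this
    convert this using 1; abel
  · have := mem_reach_cons (x := v) (y := x) (mem_reach_cons (x := y) (y := v) h)
    rw [Sym2.eq_swap (a := y)] at this
    convert this using 1; abel

/-- Two parallel edges may be deleted. -/
theorem reach_parallel {v x : V} {H : Multiset (Sym2 V)} {f : V → ZMod 6}
    (hf : f ∈ reach H) : f ∈ reach (s(v, x) ::ₘ s(v, x) ::ₘ H) := by
  have := mem_reach_cons (x := v) (y := x) (mem_reach_cons (x := x) (y := v) hf)
  rw [Sym2.eq_swap (a := x)] at this
  convert this using 1; abel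

theorem sum_single {M : Type*} [AddCommMonoid M] (A : Finset V) (x : V) (a : M) :
    ∑ v ∈ A, (Pi.single x a : V → M) v = if x ∈ A then a else 0 := by
  simp [Pi.single_apply]

/-- The net flow out of `A` is a sum of one sign for each edge of the cut. These are the necessary
conditions for a demand to be met. -/
theorem norm6_sum_le_cut {H : Multiset (Sym2 V)} {f : V → ZMod 6} (hf : f ∈ reach H)
    (A : Finset V) : norm6 (∑ v ∈ A, f v) ≤ cut H A ∧
      parity (∑ v ∈ A, f v) = cut H A := by
  induction H using Multiset.induction generalizing f with
  | empty =>
    have : f = 0 := by simpa using hf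
    simp [this, norm6_zero]
  | cons e H ih =>
    induction e with | _ x y =>
    have key : ∀ (a b c : ZMod 6) (n : ℕ), norm6 a ≤ n ∧ parity a = n → (b = 1 ∨ b = -1) →
        c = a + b → norm6 c ≤ n + 1 ∧ parity c = ((n + 1 : ℕ) : ZMod 2) := by
      rintro a b c n h hb rfl
      have h1 : norm6 b = 1 := by rcases hb with rfl | rfl <;> decide
      refine ⟨(norm6_add_le a b).trans (by omega), ?_⟩
      rw [map_add, h.2, Nat.cast_add, ← parity_norm6 b, h1]
    rw [cut_cons]
    rcases reach_cons_cases hf with h | h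
    all_goals
      have h := ih h
      simp only [Pi.sub_apply, Pi.add_apply, Finset.sum_sub_distrib, Finset.sum_add_distrib,
        sum_single] at h
      by_cases hx : x ∈ A <;> by_cases hy : y ∈ A <;>
        simp only [hx, hy, if_true, if_false, sub_self, sub_zero, add_zero, zero_sub, iff_false,
          iff_true, not_true] at h ⊢
      all_goals first
        | exact h
        | exact key _ 1 _ _ h (Or.inl rfl) (by ring1)
        | exact key _ (-1) _ _ h (Or.inr rfl) (by ring1)

theorem sum_eq_zero_of_cut {H : Multiset (Sym2 V)} {f : V → ZMod 6} (hf : f ∈ reach H)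
    {A : Finset V} (h : cut H A = 0) : ∑ v ∈ A, f v = 0 := by
  have := (norm6_sum_le_cut hf A).1
  rw [h] at this
  exact norm6_eq_zero.1 (Nat.le_zero.1 this)

theorem parity_apply {H : Multiset (Sym2 V)} {f : V → ZMod 6} (hf : f ∈ reach H) (v : V) :
    parity (f v) = cut H {v} := by
  simpa using (norm6_sum_le_cut hf {v}).2

theorem norm6_apply_le {H : Multiset (Sym2 V)} {f : V → ZMod 6} (hf : f ∈ reach H) (v : V) :
    norm6 (f v) ≤ cut H {v} := by
  simpa using (norm6_sum_le_cut hf {v}).1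

theorem apply_eq_zero_of_cut {H : Multiset (Sym2 V)} {f : V → ZMod 6} (hf : f ∈ reach H)
    {v : V} (h : cut H {v} = 0) : f v = 0 := by
  simpa using sum_eq_zero_of_cut hf h

/-- A vertex of degree at least two can be given every boundary value of the right parity. -/
theorem exists_reach_apply_eq (H : Multiset (Sym2 V)) (v : V) (r : ZMod 6)
    (hr : parity r = cut H {v}) (h : norm6 r ≤ cut H {v} ∨ 2 ≤ cut H {v}) :
    ∃ f ∈ reach H, f v = r := by
  induction H using Multiset.induction generalizing r with
  | empty =>
    refine ⟨0, by simp, ?_⟩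
    simp only [cut_zero, nonpos_iff_eq_zero, norm6_eq_zero] at h
    rcases h with h | h
    · simp [h]
    · omega
  | cons e H ih =>
    induction e with | _ x y =>
    rw [cut_cons] at hr h
    simp only [Finset.mem_singleton] at hr h
    -- A vertex of degree n attains the values -n, -n + 2, …, n. From n = 2 on these cover all three
    -- residues of the right parity, so the sign of the edge peeled off matters only for smaller n.
    have step : ∀ (n : ℕ) (r : ZMod 6), parity r = ((n + 1 : ℕ) : ZMod 2) →
        (norm6 r ≤ n + 1 ∨ 2 ≤ n + 1) → ∃ a : ZMod 6, (a = 1 ∨ a = -1) ∧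
          parity (r - a) = n ∧ (norm6 (r - a) ≤ n ∨ 2 ≤ n) := by
      intro n r h1 h2
      have hp : ∀ a : ZMod 6, (a = 1 ∨ a = -1) → parity (r - a) = n := by
        rintro a ha
        rw [map_sub, h1]
        rcases ha with rfl | rfl <;> simp [CharTwo.neg_eq]
      rcases Nat.lt_or_ge n 2 with hn | hn
      · interval_cases n
        · have : ∀ r : ZMod 6, parity r = ((0 + 1 : ℕ) : ZMod 2) → (norm6 r ≤ 0 + 1 ∨ 2 ≤ 0 + 1) →
            ∃ a : ZMod 6, (a = 1 ∨ a = -1) ∧ (norm6 (r - a) ≤ 0 ∨ 2 ≤ 0) := by decide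
          obtain ⟨a, h3, h4⟩ := this r h1 h2
          exact ⟨a, h3, hp a h3, h4⟩
        · have : ∀ r : ZMod 6, parity r = ((1 + 1 : ℕ) : ZMod 2) →
            ∃ a : ZMod 6, (a = 1 ∨ a = -1) ∧ (norm6 (r - a) ≤ 1 ∨ 2 ≤ 1) := by decide
          obtain ⟨a, h3, h4⟩ := this r h1
          exact ⟨a, h3, hp a h3, h4⟩
      · exact ⟨1, Or.inl rfl, hp 1 (Or.inl rfl), Or.inr hn⟩
    by_cases hx : x = v <;> by_cases hy : y = v
    · simp only [hx, hy, if_true, add_zero] at hr h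
      obtain ⟨f, hf, hfv⟩ := ih r hr h
      refine ⟨_, mem_reach_cons hf, by simp [hx, hy, hfv]⟩
    · simp only [hx, hy, iff_false, not_true, if_false] at hr h
      obtain ⟨a, ha, h1, h2⟩ := step _ r hr h
      obtain ⟨f, hf, hfv⟩ := ih _ h1 h2
      rcases ha with rfl | rfl
      · exact ⟨_, mem_reach_cons hf, by simp [hx, hfv, Ne.symm hy]⟩
      · rw [Sym2.eq_swap]
        exact ⟨_, mem_reach_cons hf, by simp [hx, hfv, Ne.symm hy]⟩
    · simp only [hx, hy, false_iff, not_true, if_false] at hr h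
      obtain ⟨a, ha, h1, h2⟩ := step _ r hr h
      obtain ⟨f, hf, hfv⟩ := ih _ h1 h2
      rcases ha with rfl | rfl
      · rw [Sym2.eq_swap]
        exact ⟨_, mem_reach_cons hf, by simp [hy, hfv, Ne.symm hx]⟩
      · exact ⟨_, mem_reach_cons hf, by simp [hy, hfv, Ne.symm hx]⟩
    · simp only [hx, hy, if_true, add_zero] at hr h
      obtain ⟨f, hf, hfv⟩ := ih r hr h
      refine ⟨_, mem_reach_cons hf, by simp [Ne.symm hx, Ne.symm hy, hfv]⟩

/-- The pushforward of a function on the vertices along `p`. -/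
def pushforward [Fintype V] (p : V → V) : (V → ZMod 6) →+ (V → ZMod 6) where
  toFun f v := ∑ u with p u = v, f u
  map_zero' := by ext; simp
  map_add' f g := by ext; simp [Finset.sum_add_distrib]

theorem pushforward_single [Fintype V] (p : V → V) (x : V) (a : ZMod 6) :
    pushforward p (Pi.single x a) = Pi.single (p x) a := by
  ext v
  simp [pushforward, Pi.single_apply, eq_comm]

/-- The boundaries of a contraction are the images of the boundaries of the graph. -/
theorem exists_reach_of_map [Fintype V] (p : V → V) {H : Multiset (Sym2 V)} {f : V → ZMod 6}
    (hf : f ∈ reach (H.map (Sym2.map p))) : ∃ g ∈ reach H, pushforward p g = f := by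
  induction H using Multiset.induction generalizing f with
  | empty => exact ⟨0, by simp, by simpa using hf.symm⟩
  | cons e H ih =>
    induction e with | _ x y =>
    rw [Multiset.map_cons, Sym2.map_mk] at hf
    rcases reach_cons_cases hf with h | h
    · obtain ⟨g, hg, h⟩ := ih h
      refine ⟨_, mem_reach_cons hg, ?_⟩
      rw [map_add, h, map_sub, pushforward_single, pushforward_single]
      abel
    · obtain ⟨g, hg, h⟩ := ih h
      rw [Sym2.eq_swap]
      refine ⟨_, mem_reach_cons hg, ?_⟩
      rw [map_add, h, map_sub, pushforward_single, pushforward_single]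
      abel

end EdgeMultiset

namespace EdgeMultiset

variable {V : Type*}

/-! ### Restriction to a vertex set and contraction -/

open Classical in
/-- The edges of `H` with both ends in `A`. -/
noncomputable def inside (H : Multiset (Sym2 V)) (A : Finset V) : Multiset (Sym2 V) :=
  H.filter (fun e => ∀ v ∈ e, v ∈ A)

open Classical in
/-- The edges of `H` with at most one end in `A`. -/
noncomputable def notInside (H : Multiset (Sym2 V)) (A : Finset V) : Multiset (Sym2 V) :=
  H.filter (fun e => ¬∀ v ∈ e, v ∈ A)

open Classical in
theorem inside_add_notInside (H : Multiset (Sym2 V)) (A : Finset V) :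
    inside H A + notInside H A = H :=
  Multiset.filter_add_not _ H

open Classical in
theorem mem_inside {H : Multiset (Sym2 V)} {A : Finset V} {e : Sym2 V} :
    e ∈ inside H A ↔ e ∈ H ∧ ∀ v ∈ e, v ∈ A :=
  Multiset.mem_filter

open Classical in
theorem mem_notInside {H : Multiset (Sym2 V)} {A : Finset V} {e : Sym2 V} :
    e ∈ notInside H A ↔ e ∈ H ∧ ¬∀ v ∈ e, v ∈ A :=
  Multiset.mem_filter

theorem cut_inside_add (H : Multiset (Sym2 V)) (A B : Finset V) :
    cut H B = cut (inside H A) B + cut (notInside H A) B := by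
  rw [← cut_add, inside_add_notInside]

theorem cut_self {H : Multiset (Sym2 V)} {S : Finset V} (hH : ∀ e ∈ H, ∀ v ∈ e, v ∈ S) :
    cut H S = 0 := by
  refine cut_eq_zero fun e he => ?_
  induction e with | _ x y =>
  simp [crosses_mk, hH _ he x (Sym2.mem_mk_left x y), hH _ he y (Sym2.mem_mk_right x y)]

theorem cut_inside_eq_zero {H : Multiset (Sym2 V)} {A B : Finset V} (hB : ∀ v ∈ A, v ∉ B) :
    cut (inside H A) B = 0 := by
  refine cut_eq_zero fun e he => ?_
  have h := (mem_inside.1 he).2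
  induction e with | _ x y =>
  simp [crosses_mk, hB _ (h x (Sym2.mem_mk_left x y)), hB _ (h y (Sym2.mem_mk_right x y))]

variable [DecidableEq V]

theorem reach_nonempty (H : Multiset (Sym2 V)) : (reach H).Nonempty := by
  induction H using Multiset.induction with
  | empty => exact ⟨0, by simp⟩
  | cons e H ih =>
    induction e with | _ x y =>
    obtain ⟨f, hf⟩ := ih
    exact ⟨_, mem_reach_cons hf⟩

theorem cut_sdiff {H : Multiset (Sym2 V)} {S A : Finset V} (hH : ∀ e ∈ H, ∀ v ∈ e, v ∈ S) :
    cut H (S \ A) = cut H A := by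
  classical
  refine Multiset.countP_congr rfl fun e he => ?_
  induction e with | _ x y =>
  have h1 := hH _ he x (Sym2.mem_mk_left x y)
  have h2 := hH _ he y (Sym2.mem_mk_right x y)
  simp only [crosses_mk, Finset.mem_sdiff, h1, h2, true_and, not_iff_not]

/-- Some orientation of `H` has boundary `h` on `S`. -/
def Solvable (S : Finset V) (H : Multiset (Sym2 V)) (h : V → ZMod 6) : Prop :=
  ∃ f ∈ reach H, ∀ v ∈ S, f v = h v

/-- If the edges that are not inside `A` have been oriented correctly, it remains to orient the
edges inside `A`. -/
theorem Solvable.of_restrict {S A : Finset V} {H : Multiset (Sym2 V)} {h f : V → ZMod 6}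
    (hf : f ∈ reach (notInside H A))
    (hfh : ∀ v ∈ S, v ∉ A → f v = h v)
    (hA : Solvable A (inside H A) (h - f)) : Solvable S H h := by
  obtain ⟨g, hg, hgh⟩ := hA
  refine ⟨g + f, by
    rw [← inside_add_notInside H A, reach_add]; exact Set.add_mem_add hg hf, fun v hv => ?_⟩
  by_cases hvA : v ∈ A
  · simp [hgh v hvA]
  · have : g v = 0 := apply_eq_zero_of_cut hg
      (cut_inside_eq_zero fun u hu => by rw [Finset.mem_singleton]; rintro rfl; exact hvA hu)
    simp [this, hfh v hv hvA]

theorem sum_restrict_eq_zero {S A : Finset V} {H : Multiset (Sym2 V)} {h f : V → ZMod 6}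
    (hH : ∀ e ∈ H, ∀ v ∈ e, v ∈ S) (hAS : A ⊆ S) (hsum : ∑ v ∈ S, h v = 0)
    (hf : f ∈ reach (notInside H A))
    (hfh : ∀ v ∈ S, v ∉ A → f v = h v) : ∑ v ∈ A, (h - f) v = 0 := by
  have h1 : ∑ v ∈ S, f v = 0 := sum_eq_zero_of_cut hf
    (cut_self fun e he => hH e (mem_notInside.1 he).1)
  have h2 : ∑ v ∈ S \ A, f v = ∑ v ∈ S \ A, h v := Finset.sum_congr rfl fun v hv =>
    hfh v (Finset.mem_sdiff.1 hv).1 (Finset.mem_sdiff.1 hv).2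
  rw [← Finset.sum_sdiff hAS] at h1 hsum
  simp only [Pi.sub_apply, Finset.sum_sub_distrib]
  rw [h2, ← hsum] at h1
  rw [← add_left_cancel h1, sub_self]

theorem parity_restrict {S A : Finset V} {H : Multiset (Sym2 V)} {h f : V → ZMod 6}
    (hAS : A ⊆ S) (hpar : ∀ v ∈ S, parity (h v) = cut H {v})
    (hf : f ∈ reach (notInside H A)) (v : V) (hv : v ∈ A) :
    parity ((h - f) v) = cut (inside H A) {v} := by
  rw [Pi.sub_apply, map_sub, hpar v (hAS hv), parity_apply hf,
    cut_inside_add H A, Nat.cast_add, add_sub_cancel_right]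

/-- Identification of the vertices of `A` with `a`. -/
def contraction (A : Finset V) (a v : V) : V := if v ∈ A then a else v

/-- An orientation of a contraction satisfying `h` gives an orientation of the edges that are not
inside the contracted set. -/
theorem exists_reach_of_contraction [Fintype V] {S A : Finset V} {a : V} (ha : a ∈ A)
    {H : Multiset (Sym2 V)} {h : V → ZMod 6}
    (hs : Solvable (S.image (contraction A a)) (H.map (Sym2.map (contraction A a)))
      (fun v => ∑ u ∈ S with contraction A a u = v, h u)) :
    ∃ f ∈ reach (notInside H A), ∀ v ∈ S, v ∉ A → f v = h v := by
  obtain ⟨f, hf, hfh⟩ := hs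
  obtain ⟨g, hg, rfl⟩ := exists_reach_of_map _ hf
  rw [← inside_add_notInside H A, reach_add] at hg
  obtain ⟨g₁, hg₁, g₂, hg₂, rfl⟩ := Set.mem_add.1 hg
  refine ⟨g₂, hg₂, fun v hv hvA => ?_⟩
  have hp : contraction A a v = v := if_neg hvA
  have h1 : ∀ T : Finset V, v ∈ T → T.filter (contraction A a · = v) = {v} := by
    intro T hT
    ext u
    simp only [Finset.mem_filter, Finset.mem_singleton]
    constructor
    · rintro ⟨_, hu⟩
      by_cases huA : u ∈ A
      · rw [contraction, if_pos huA] at hu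
        exact absurd (hu ▸ ha) hvA
      · rwa [contraction, if_neg huA] at hu
    · rintro rfl
      exact ⟨hT, hp⟩
  have h2 := hfh v (Finset.mem_image.2 ⟨v, hv, hp⟩)
  simp only [pushforward, AddMonoidHom.coe_mk, ZeroHom.coe_mk, h1 _ hv, h1 _ (Finset.mem_univ v),
    Finset.sum_singleton] at h2
  -- The edges inside `A` are loops of the contraction; their orientation does not affect vertices
  -- outside `A` and is discarded.
  have h3 : g₁ v = 0 := apply_eq_zero_of_cut hg₁
      (cut_inside_eq_zero fun u hu => by rw [Finset.mem_singleton]; rintro rfl; exact hvA hu)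
  simpa [h3] using h2

theorem card_image_contraction_lt {S A : Finset V} {a : V} (hAS : A ⊆ S)
    (hA : 2 ≤ A.card) : (S.image (contraction A a)).card < S.card := by
  have h1 : S.image (contraction A a) ⊆ insert a (S \ A) := by
    intro v hv
    obtain ⟨u, hu, rfl⟩ := Finset.mem_image.1 hv
    by_cases huA : u ∈ A
    · simp [contraction, huA]
    · simp [contraction, huA, hu]
  have h2 := Finset.card_le_card h1
  have h3 := Finset.card_insert_le a (S \ A)
  have h4 := Finset.card_sdiff_add_card_eq_card hAS
  omega

theorem ends_contraction {S : Finset V} {p : V → V} {H : Multiset (Sym2 V)}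
    (hH : ∀ e ∈ H, ∀ v ∈ e, v ∈ S) : ∀ e ∈ H.map (Sym2.map p), ∀ v ∈ e, v ∈ S.image p := by
  intro e he v hv
  obtain ⟨e', he', rfl⟩ := Multiset.mem_map.1 he
  obtain ⟨u, hu, rfl⟩ := Sym2.mem_map.1 hv
  exact Finset.mem_image_of_mem p (hH _ he' u hu)

theorem sum_contraction {M : Type*} [AddCommMonoid M] (S B : Finset V) (p : V → V) (φ : V → M) :
    ∑ v ∈ B, ∑ u ∈ S with p u = v, φ u = ∑ u ∈ S with p u ∈ B, φ u := by
  rw [← Finset.sum_fiberwise_of_maps_to (s := S.filter (p · ∈ B)) (t := B) (g := p)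
    (fun u hu => (Finset.mem_filter.1 hu).2)]
  refine Finset.sum_congr rfl fun v hv => Finset.sum_congr ?_ fun _ _ => rfl
  ext u
  simp only [Finset.mem_filter]
  constructor
  · rintro ⟨h1, rfl⟩; exact ⟨⟨h1, hv⟩, rfl⟩
  · rintro ⟨⟨h1, _⟩, h2⟩; exact ⟨h1, h2⟩

theorem parity_contraction {S : Finset V} {p : V → V} {H : Multiset (Sym2 V)} {h : V → ZMod 6}
    (hH : ∀ e ∈ H, ∀ v ∈ e, v ∈ S) (hpar : ∀ v ∈ S, parity (h v) = cut H {v}) (v : V) :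
    parity (∑ u ∈ S with p u = v, h u) = cut (H.map (Sym2.map p)) {v} := by
  rw [cut_map p hH, parity_cut, map_sum]
  simp only [Finset.mem_singleton]
  exact Finset.sum_congr rfl fun u hu => hpar u (Finset.mem_filter.1 hu).1

theorem filter_contraction {S B : Finset V} {p : V → V} (hB : B ⊆ S.image p) (hne : B.Nonempty)
    (hBS : B ≠ S.image p) : (S.filter (p · ∈ B)).Nonempty ∧ S.filter (p · ∈ B) ≠ S := by
  constructor
  · obtain ⟨b, hb⟩ := hne
    obtain ⟨u, hu, rfl⟩ := Finset.mem_image.1 (hB hb)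
    exact ⟨u, Finset.mem_filter.2 ⟨hu, hb⟩⟩
  · intro h
    refine hBS (hB.antisymm fun v hv => ?_)
    obtain ⟨u, hu, rfl⟩ := Finset.mem_image.1 hv
    rw [← h] at hu
    exact (Finset.mem_filter.1 hu).2

theorem solvable_of_card_le_one {S : Finset V} {H : Multiset (Sym2 V)} {h : V → ZMod 6}
    (hends : ∀ e ∈ H, ∀ v ∈ e, v ∈ S) (hsum : ∑ v ∈ S, h v = 0) (hS : S.card ≤ 1) :
    Solvable S H h := by
  obtain ⟨f, hf⟩ := reach_nonempty H
  refine ⟨f, hf, fun v hv => ?_⟩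
  have hSv : S = {v} := Finset.eq_singleton_iff_unique_mem.2
    ⟨hv, fun u hu => Finset.card_le_one.1 hS u hu v hv⟩
  have h2 := sum_eq_zero_of_cut hf (cut_self hends)
  rw [hSv, Finset.sum_singleton] at hsum h2
  rw [hsum, h2]

/-- Only the demand at `x` has to be arranged; the one at `y` follows because both sums vanish. -/
theorem solvable_pair {x y : V} (hxy : x ≠ y) {H : Multiset (Sym2 V)} {h : V → ZMod 6}
    (hends : ∀ e ∈ H, ∀ v ∈ e, v ∈ ({x, y} : Finset V))
    (hsum : ∑ v ∈ {x, y}, h v = 0) (hpar : parity (h x) = cut H {x})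
    (hcut : norm6 (h x) ≤ cut H {x} ∨ 2 ≤ cut H {x}) : Solvable {x, y} H h := by
  obtain ⟨f, hf, hfx⟩ := exists_reach_apply_eq H x (h x) hpar hcut
  refine ⟨f, hf, fun v hv => ?_⟩
  have h2 := sum_eq_zero_of_cut hf (cut_self hends)
  rw [Finset.sum_pair hxy] at h2 hsum
  rcases Finset.mem_insert.1 hv with rfl | hv
  · exact hfx
  · rw [Finset.mem_singleton.1 hv]
    rw [hfx, ← hsum] at h2
    exact add_left_cancel h2

/-! ### The extension theorem: admissible instances and tight sets -/

/-- The hypotheses of the extension theorem. The functions `w` and `s` record the number and the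
net direction of the edges that join a vertex to an additional vertex, all of whose edges have
been oriented. The vertex `v₀` is exempt from the degree condition if its demand is zero. -/
structure Admissible (S : Finset V) (H : Multiset (Sym2 V)) (h s : V → ZMod 6) (w : V → ℕ)
    (v₀ : V) : Prop where
  ends : ∀ e ∈ H, ∀ v ∈ e, v ∈ S
  parity_h : ∀ v ∈ S, parity (h v) = cut H {v}
  sum_h : ∑ v ∈ S, h v = 0
  norm_s : ∀ v ∈ S, norm6 (s v) ≤ w v
  parity_s : ∀ v ∈ S, parity (s v) = w v
  top : ∑ v ∈ S, w v ≤ 4 + norm6 (∑ v ∈ S, s v)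
  cond : ∀ A ⊆ S, A.Nonempty → A ≠ S → (A = {v₀} ∧ h v₀ + s v₀ = 0) ∨
    4 + norm6 (∑ v ∈ A, (h v + s v)) ≤ cut H A + ∑ v ∈ A, w v

/-- Every admissible instance of size less than `n` is solvable. -/
def SolvableBelow (V : Type*) [DecidableEq V] (n : ℕ) : Prop :=
  ∀ (S : Finset V) (H : Multiset (Sym2 V)) (h s : V → ZMod 6) (w : V → ℕ) (v₀ : V),
    Admissible S H h s w v₀ → S.card + 2 * H.card + ∑ v ∈ S, w v < n → Solvable S H h

variable {S : Finset V} {H : Multiset (Sym2 V)} {h s : V → ZMod 6} {w : V → ℕ} {v₀ : V}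

namespace Admissible

/-- Because of this parity, a degree condition that is not an equality holds with slack at least
two. -/
theorem parity_sum {V : Type*} {S : Finset V} {H : Multiset (Sym2 V)} {h s : V → ZMod 6}
    {w : V → ℕ} {v₀ : V}
    (ad : Admissible S H h s w v₀) {A : Finset V} (hA : A ⊆ S) :
    parity (∑ v ∈ A, (h v + s v)) = ((cut H A + ∑ v ∈ A, w v : ℕ) : ZMod 2) := by
  rw [Nat.cast_add, parity_cut, Finset.sum_add_distrib, map_add, map_sum, map_sum, Nat.cast_sum]
  congr 1
  · exact Finset.sum_congr rfl fun v hv => ad.parity_h v (hA hv)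
  · exact Finset.sum_congr rfl fun v hv => ad.parity_s v (hA hv)

/-- Once the edges not inside `A` are oriented, the complement of `A` is absorbed into the
additional vertex. Tightness of `A` is exactly the upper bound required on the degree of that
vertex. -/
theorem restrict (ad : Admissible S H h s w v₀) {A : Finset V} (hAS : A ⊆ S) (hA : A ≠ S)
    (htight : cut H A + ∑ v ∈ A, w v ≤ 4 + norm6 (∑ v ∈ A, (h v + s v))) {f : V → ZMod 6}
    (hf : f ∈ reach (notInside H A))
    (hfh : ∀ v ∈ S, v ∉ A → f v = h v)
    (ih : SolvableBelow V (S.card + 2 * H.card + ∑ v ∈ S, w v)) : Solvable S H h := by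
  refine Solvable.of_restrict hf hfh ?_
  set H₁ := inside H A
  set H₂ := notInside H A
  have hcut : ∀ B, cut H B = cut H₁ B + cut H₂ B := cut_inside_add H A
  have hcard : H.card = H₁.card + H₂.card := by
    rw [← Multiset.card_add, inside_add_notInside]
  have hcut₂ : ∀ B ⊆ A, ∑ v ∈ B, cut H₂ {v} = cut H₂ B := fun B hB =>
    (cut_eq_sum fun e he hall => (mem_notInside.1 he).2 fun v hv => hB (hall v hv)).symm
  have hends : ∀ e ∈ H₁, ∀ v ∈ e, v ∈ A := fun e he => (mem_inside.1 he).2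
  have hsum := sum_restrict_eq_zero ad.ends hAS ad.sum_h hf hfh
  -- The flow `f` moves from `h` to `s`, so the total demand `h + s` is unchanged. In the induction
  -- measure an edge of `H` weighs two and an additional edge one, so converting edges does not
  -- increase it.
  refine ih A H₁ (h - f) (s + f) (fun v => w v + cut H₂ {v}) v₀
    ⟨hends, parity_restrict hAS ad.parity_h hf, hsum, ?_, ?_, ?_, ?_⟩ ?_
  · intro v hv
    exact (norm6_add_le _ _).trans (add_le_add (ad.norm_s v (hAS hv)) (norm6_apply_le hf v))
  · intro v hv
    rw [Pi.add_apply, map_add, ad.parity_s v (hAS hv), parity_apply hf, Nat.cast_add]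
  · rw [Finset.sum_add_distrib, hcut₂ A subset_rfl]
    have h1 := hcut A
    rw [cut_self hends] at h1
    have h2 : ∑ v ∈ A, (s + f) v = ∑ v ∈ A, (h v + s v) := by
      simp only [Pi.sub_apply, Finset.sum_sub_distrib, sub_eq_zero] at hsum
      simp only [Pi.add_apply, Finset.sum_add_distrib, hsum, add_comm]
    rw [h2]
    omega
  · intro B hB hne hBA
    have h1 : ∑ v ∈ B, ((h - f) v + (s + f) v) = ∑ v ∈ B, (h v + s v) :=
      Finset.sum_congr rfl fun v _ => by simp only [Pi.sub_apply, Pi.add_apply]; ring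
    rw [h1, Finset.sum_add_distrib (f := w), hcut₂ B hB]
    rcases ad.cond B (hB.trans hAS) hne (fun h => hBA (hB.antisymm (h ▸ hAS))) with h2 | h2
    · left
      refine ⟨h2.1, ?_⟩
      rw [← h2.2]
      simp only [Pi.sub_apply, Pi.add_apply]; ring
    · right
      have := hcut B
      omega
  · rw [Finset.sum_add_distrib, hcut₂ A subset_rfl]
    have h1 := cut_le_card H₂ A
    have h2 := Finset.sum_le_sum_of_subset (f := w) hAS
    have h3 := Finset.card_lt_card (hAS.ssubset_of_ne hA)
    omega

/-- An instance with a tight set of at least two vertices splits into two smaller ones. -/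
theorem of_tight [Fintype V] (ad : Admissible S H h s w v₀) {A : Finset V} (hAS : A ⊆ S)
    (hA : A ≠ S) (hA2 : 2 ≤ A.card)
    (htight : cut H A + ∑ v ∈ A, w v ≤ 4 + norm6 (∑ v ∈ A, (h v + s v)))
    (ih : SolvableBelow V (S.card + 2 * H.card + ∑ v ∈ S, w v)) : Solvable S H h := by
  obtain ⟨a, ha⟩ : A.Nonempty := Finset.card_pos.1 (by omega)
  obtain ⟨p, hp⟩ : ∃ p, p = contraction A a := ⟨_, rfl⟩
  have hS : S.filter (p · ∈ S.image p) = S :=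
    Finset.filter_true_of_mem fun u hu => Finset.mem_image_of_mem p hu
  obtain ⟨f, hf, hfh⟩ := exists_reach_of_contraction (S := S) (H := H) (h := h) ha (by
    rw [← hp]
    refine ih (S.image p) (H.map (Sym2.map p)) _ (fun v => ∑ u ∈ S with p u = v, s u)
      (fun v => ∑ u ∈ S with p u = v, w u) (p v₀) ⟨ends_contraction ad.ends,
        fun v _ => parity_contraction ad.ends ad.parity_h v, ?_, ?_, ?_, ?_, ?_⟩ ?_
    · rw [sum_contraction, hS, ad.sum_h]
    · intro v _
      exact (norm6_sum_le _ _).trans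
        (Finset.sum_le_sum fun u hu => ad.norm_s u (Finset.mem_filter.1 hu).1)
    · intro v _
      rw [map_sum, Nat.cast_sum]
      exact Finset.sum_congr rfl fun u hu => ad.parity_s u (Finset.mem_filter.1 hu).1
    · rw [sum_contraction, sum_contraction, hS]
      exact ad.top
    · intro B hB hne hBS
      obtain ⟨h1, h2⟩ := filter_contraction hB hne hBS
      rcases ad.cond _ (Finset.filter_subset _ S) h1 h2 with ⟨h3, h4⟩ | h3
      · left
        -- The exemption is needed only if the preimage of `B` is the exempt vertex alone, so it
        -- passes to the image of that vertex.
        have hB0 : B = {p v₀} := by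
          refine Finset.eq_singleton_iff_nonempty_unique_mem.2 ⟨hne, fun b hb => ?_⟩
          obtain ⟨u, hu, rfl⟩ := Finset.mem_image.1 (hB hb)
          have : u ∈ S.filter (p · ∈ B) := Finset.mem_filter.2 ⟨hu, hb⟩
          rw [h3, Finset.mem_singleton] at this
          rw [this]
        refine ⟨hB0, ?_⟩
        rw [hB0] at h3
        simp only [Finset.mem_singleton] at h3
        simp only [h3, Finset.sum_singleton, h4]
      · right
        rw [← Finset.sum_add_distrib.symm] at h3
        rw [Finset.sum_add_distrib, sum_contraction, sum_contraction, sum_contraction,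
          cut_map p ad.ends]
        exact h3
    · rw [sum_contraction, hS, Multiset.card_map]
      have := card_image_contraction_lt (a := a) hAS hA2
      rw [← hp] at this
      omega)
  exact ad.restrict hAS hA htight hf hfh ih

/-- Reversal of all edges; it reduces the case of negative demands to that of positive ones. -/
theorem neg {V : Type*} {S : Finset V} {H : Multiset (Sym2 V)} {h s : V → ZMod 6}
    {w : V → ℕ} {v₀ : V}
    (ad : Admissible S H h s w v₀) : Admissible S H (-h) (-s) w v₀ where
  ends := ad.ends
  parity_h v hv := by rw [Pi.neg_apply, map_neg, CharTwo.neg_eq, ad.parity_h v hv]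
  sum_h := by simp [ad.sum_h]
  norm_s v hv := by rw [Pi.neg_apply, norm6_neg]; exact ad.norm_s v hv
  parity_s v hv := by rw [Pi.neg_apply, map_neg, CharTwo.neg_eq, ad.parity_s v hv]
  top := by
    simp only [Pi.neg_apply, Finset.sum_neg_distrib, norm6_neg]
    exact ad.top
  cond A hA hne hAS := by
    have h1 : ∑ v ∈ A, ((-h) v + (-s) v) = -∑ v ∈ A, (h v + s v) := by
      rw [← Finset.sum_neg_distrib]
      exact Finset.sum_congr rfl fun v _ => by simp only [Pi.neg_apply]; ring
    rw [h1, norm6_neg]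
    refine (ad.cond A hA hne hAS).imp_left fun h2 => ⟨h2.1, ?_⟩
    rw [Pi.neg_apply, Pi.neg_apply, ← neg_add, h2.2, neg_zero]

/-- If neither vertex uses the exemption, adding the two degree conditions and comparing with `top`
leaves at least two edges between the vertices. If one does, the same comparison bounds its
additional degree, hence the norm of its demand on `H`, by the number of edges between them. -/
theorem solvable_of_card_eq_two (ad : Admissible S H h s w v₀) (hS : S.card = 2) :
    Solvable S H h := by
  obtain ⟨x, y, hxy, rfl⟩ := Finset.card_eq_two.1 hS
  have hx : ({x} : Finset V) ⊆ {x, y} := by simp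
  have hy : ({y} : Finset V) ⊆ {x, y} := by simp
  have hne : ∀ z : V, ({z} : Finset V) ≠ {x, y} := by
    intro z hz
    have := congrArg Finset.card hz
    rw [hS] at this
    simp at this
  have hcut : cut H {y} = cut H {x} := by
    rw [← cut_sdiff (A := {x}) ad.ends]
    congr 1
    ext z
    simp only [Finset.mem_sdiff, Finset.mem_insert, Finset.mem_singleton]
    constructor
    · rintro rfl; exact ⟨Or.inr rfl, hxy.symm⟩
    · tauto
  have hsum := ad.sum_h
  have htop := ad.top
  rw [Finset.sum_pair hxy] at hsum
  rw [Finset.sum_pair hxy, Finset.sum_pair hxy] at htop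
  have hyx : h y = -h x := by rw [eq_neg_iff_add_eq_zero, add_comm, hsum]
  refine solvable_pair hxy ad.ends ad.sum_h (ad.parity_h x (by simp)) ?_
  have hsx := ad.norm_s x (by simp)
  have hsy := ad.norm_s y (by simp)
  have ht : s x + s y = (h x + s x) + (h y + s y) := by rw [hyx]; ring
  have cx := ad.cond {x} hx (by simp) (hne x)
  have cy := ad.cond {y} hy (by simp) (hne y)
  rw [Finset.sum_singleton, Finset.sum_singleton] at cx cy
  rw [hcut] at cy
  rw [ht] at htop
  have h3 := norm6_add_le (h x + s x) (h y + s y)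
  rcases cx with ⟨e, cx⟩ | cx
  · have e := Finset.singleton_injective e
    subst e
    rw [cx, zero_add] at htop
    have e' : norm6 (h x) = norm6 (s x) := by
      rw [eq_neg_of_add_eq_zero_left cx, norm6_neg]
    rcases cy with ⟨e, _⟩ | cy
    · exact absurd (Finset.singleton_injective e).symm hxy
    · left; omega
  · rcases cy with ⟨e, cy⟩ | cy
    · have e := Finset.singleton_injective e
      subst e
      rw [cy, add_zero] at htop
      have e' : norm6 (h x) = norm6 (s y) := by
        rw [← norm6_neg, ← hyx, eq_neg_of_add_eq_zero_left cy, norm6_neg]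
      left; omega
    · right; omega

end Admissible

end EdgeMultiset

namespace EdgeMultiset

variable {V : Type*}

/-! ### Lifting edges at a vertex -/

/-- Every set of at least two vertices, other than the whole vertex set, exceeds the degree
condition by two. -/
def Slack (S : Finset V) (H : Multiset (Sym2 V)) (h s : V → ZMod 6) (w : V → ℕ) : Prop :=
  ∀ A ⊆ S, 2 ≤ A.card → A ≠ S → 6 + norm6 (∑ v ∈ A, (h v + s v)) ≤ cut H A + ∑ v ∈ A, w v

theorem degree_condition {S : Finset V} {H : Multiset (Sym2 V)} {h s : V → ZMod 6} {w : V → ℕ}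
    {v₀ : V} (single : ∀ u ∈ S, (u = v₀ ∧ h u + s u = 0) ∨ 4 + norm6 (h u + s u) ≤ cut H {u} + w u)
    (big : ∀ A ⊆ S, 2 ≤ A.card → A ≠ S →
      4 + norm6 (∑ v ∈ A, (h v + s v)) ≤ cut H A + ∑ v ∈ A, w v) :
    ∀ A ⊆ S, A.Nonempty → A ≠ S → (A = {v₀} ∧ h v₀ + s v₀ = 0) ∨
      4 + norm6 (∑ v ∈ A, (h v + s v)) ≤ cut H A + ∑ v ∈ A, w v := by
  intro A hA hne hAS
  have := hne.card_pos
  rcases Nat.lt_or_ge A.card 2 with h2 | h2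
  · obtain ⟨u, rfl⟩ := Finset.card_eq_one.1 (show A.card = 1 by omega)
    simp only [Finset.sum_singleton]
    refine (single u (by simpa using hA)).imp_left ?_
    rintro ⟨rfl, h3⟩
    exact ⟨rfl, h3⟩
  · exact Or.inr (big A hA h2 hAS)

/-- If `a` is the net direction of `n` oriented edges, then `b` is the direction of one that can be
taken away. -/
theorem exists_norm6_sub_lt {a : ZMod 6} {n : ℕ} (h : norm6 a ≤ n) (hp : parity a = n)
    (hn : 0 < n) : ∃ b : ZMod 6, (b = 1 ∨ b = -1) ∧ norm6 (a - b) + 1 ≤ n := by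
  rcases Nat.lt_or_ge n 4 with h4 | h4
  · have : ∀ n : Fin 4, ∀ a : ZMod 6, norm6 a ≤ n → parity a = ((n : ℕ) : ZMod 2) → 0 < (n : ℕ) →
        ∃ b : ZMod 6, (b = 1 ∨ b = -1) ∧ norm6 (a - b) + 1 ≤ n := by decide
    exact this ⟨n, h4⟩ a h hp hn
  · exact ⟨1, Or.inl rfl, by have := norm6_le_three (a - 1); omega⟩

theorem norm6_le_of_eq_add {a b c : ZMod 6} (h : c = a + b) : norm6 c ≤ norm6 a + norm6 b :=
  h ▸ norm6_add_le a b

theorem cut_add_le_of_parallel {H : Multiset (Sym2 V)} {v x : V} (hvx : x ≠ v)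
    (h : ∀ y, s(v, y) ∈ H → y = v ∨ y = x) [DecidableEq V] :
    cut H {x} = cut H {v, x} + cut H {v} := by
  induction H using Multiset.induction with
  | empty => simp
  | cons e H ih =>
    have ih' := ih fun y hy => h y (Multiset.mem_cons_of_mem hy)
    induction e with | _ a b =>
    simp only [cut_cons, ih', Finset.mem_insert, Finset.mem_singleton]
    have h1 : a = v → b = v ∨ b = x := fun h' => h b (by simp [h'])
    have h2 : b = v → a = v ∨ a = x := fun h' => h a (by simp [h', Sym2.eq_swap])
    by_cases hav : a = v <;> by_cases hbv : b = v <;> by_cases hax : a = x <;>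
      by_cases hbx : b = x <;> simp_all <;> omega

variable [DecidableEq V] {S : Finset V} {K H : Multiset (Sym2 V)} {h s : V → ZMod 6} {w : V → ℕ}
  {v₀ v x y : V}

theorem single_sub_single_mem {a : ZMod 6} (ha : a = 1 ∨ a = -1) (x y : V) :
    (Pi.single x a - Pi.single y a : V → ZMod 6) ∈ edgeBoundary s(x, y) := by
  rw [mem_edgeBoundary]
  rcases ha with rfl | rfl
  · left; rfl
  · right; rw [Pi.single_neg, Pi.single_neg]; abel

theorem Solvable.cons {e : Sym2 V} {g : V → ZMod 6} (hg : g ∈ edgeBoundary e)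
    (hs : Solvable S K (h - g)) : Solvable S (e ::ₘ K) h := by
  obtain ⟨f, hf, hfh⟩ := hs
  refine ⟨g + f, ?_, fun v hv => by simp [hfh v hv]⟩
  rw [reach_cons]
  exact Set.add_mem_add hg hf

theorem edgeBoundary_eq (e : Sym2 V) : edgeBoundary e = reach {e} := by
  simp [reach]

theorem cut_cons_eq {V : Type*} {K : Multiset (Sym2 V)} (e : Sym2 V) (A : Finset V) : cut (e ::ₘ K) A = cut {e} A + cut K A := by
  rw [← cut_add, Multiset.singleton_add]

theorem parity_sub_of_mem {e : Sym2 V} {g : V → ZMod 6} (hg : g ∈ edgeBoundary e) (u : V)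
    (hu : parity (h u) = cut (e ::ₘ K) {u}) : parity ((h - g) u) = cut K {u} := by
  rw [edgeBoundary_eq] at hg
  rw [Pi.sub_apply, map_sub, hu, parity_apply hg, cut_cons_eq, Nat.cast_add, add_sub_cancel_left]

theorem sum_eq_zero_of_mem {e : Sym2 V} {g : V → ZMod 6} (hg : g ∈ edgeBoundary e)
    (he : ∀ v ∈ e, v ∈ S) : ∑ v ∈ S, g v = 0 := by
  rw [edgeBoundary_eq] at hg
  exact sum_eq_zero_of_cut hg (cut_self (by simpa using he))

theorem exists_cut_lift (A : Finset V) : ∃ k ≤ 1,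
    cut (s(v, x) ::ₘ s(v, y) ::ₘ K) A = cut (s(x, y) ::ₘ K) A + 2 * k := by
  simp only [cut_cons]
  by_cases hv : v ∈ A <;> by_cases hx : x ∈ A <;> by_cases hy : y ∈ A <;> simp only [hv, hx, hy,
    if_true, if_false, iff_false, iff_true, not_true]
  · exact ⟨0, by omega⟩
  · exact ⟨0, by omega⟩
  · exact ⟨0, by omega⟩
  · exact ⟨1, by omega⟩
  · exact ⟨1, by omega⟩
  · exact ⟨0, by omega⟩
  · exact ⟨0, by omega⟩
  · exact ⟨0, by omega⟩

theorem exists_cut_parallel (A : Finset V) : ∃ k ≤ 1,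
    cut (s(v, x) ::ₘ s(v, x) ::ₘ K) A = cut K A + 2 * k := by
  simp only [cut_cons]
  split_ifs
  · exact ⟨0, by omega⟩
  · exact ⟨1, by omega⟩

theorem sum_shift {w w' : V → ℕ} {v x : V} (hw : ∀ u, w' u + (Pi.single v 1 : V → ℕ) u =
    w u + (Pi.single x 1 : V → ℕ) u) (A : Finset V) :
    ∑ u ∈ A, w' u + (if v ∈ A then 1 else 0) = ∑ u ∈ A, w u + if x ∈ A then 1 else 0 := by
  rw [← sum_single A v, ← sum_single A x, ← Finset.sum_add_distrib, ← Finset.sum_add_distrib]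
  exact Finset.sum_congr rfl fun u _ => hw u

namespace Admissible

/-- Lifting a pair of edges `vx`, `vy`. -/
theorem solvable_of_lift (ad : Admissible S (s(v, x) ::ₘ s(v, y) ::ₘ K) h s w v₀)
    (hx : x ≠ v) (hy : y ≠ v) (hxy : x ≠ y)
    (hslack : Slack S (s(v, x) ::ₘ s(v, y) ::ₘ K) h s w)
    (hs : ∀ u ∈ S, u ≠ v → 4 + norm6 (h u + s u) ≤ cut (s(v, x) ::ₘ s(v, y) ::ₘ K) {u} + w u)
    (hv : h v + s v = 0 ∨ 6 + norm6 (h v + s v) ≤ cut (s(v, x) ::ₘ s(v, y) ::ₘ K) {v} + w v)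
    (ih : SolvableBelow V (S.card + 2 * (s(v, x) ::ₘ s(v, y) ::ₘ K).card + ∑ v ∈ S, w v)) :
    Solvable S (s(v, x) ::ₘ s(v, y) ::ₘ K) h := by
  obtain ⟨f, hf, hfh⟩ : Solvable S (s(x, y) ::ₘ K) h := by
    -- The exemption moves to `v`. As `x` and `y` differ, no other single vertex loses degree, and a
    -- larger set loses at most the two edges its slack allows.
    refine ih S _ h s w v ⟨?_, ?_, ad.sum_h, ad.norm_s, ad.parity_s, ad.top, ?_⟩ ?_
    · have := ad.ends
      simp only [Multiset.forall_mem_cons, Sym2.ball] at this ⊢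
      exact ⟨⟨this.1.2, this.2.1.2⟩, this.2.2⟩
    · intro u hu
      obtain ⟨k, _, h2⟩ := exists_cut_lift (v := v) (x := x) (y := y) (K := K) {u}
      rw [ad.parity_h u hu, h2, Nat.cast_add, Nat.cast_mul, show ((2 : ℕ) : ZMod 2) = 0 from rfl,
        zero_mul, add_zero]
    · refine degree_condition (fun u hu => ?_) fun A hA hA2 hAS => ?_
      · rcases eq_or_ne u v with rfl | huv
        · rcases hv with hv | hv
          · exact Or.inl ⟨rfl, hv⟩
          · obtain ⟨k, _, h2⟩ := exists_cut_lift (v := u) (x := x) (y := y) (K := K) {u}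
            right; omega
        · right
          have h1 := hs u hu huv
          simp only [cut_cons, Finset.mem_singleton] at h1 ⊢
          have h2 : x = u → y ≠ u := by rintro rfl rfl; exact hxy rfl
          by_cases hxu : x = u <;> by_cases hyu : y = u <;> simp_all [Ne.symm huv]
      · have h1 := hslack A hA hA2 hAS
        obtain ⟨k, _, h2⟩ := exists_cut_lift (v := v) (x := x) (y := y) (K := K) A
        omega
    · simp only [Multiset.card_cons]
      omega
  exact ⟨f, reach_lift hf, hfh⟩

/-- Deleting a pair of parallel edges at a vertex with only one neighbour. -/
theorem solvable_of_parallel (ad : Admissible S (s(v, x) ::ₘ s(v, x) ::ₘ K) h s w v₀)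
    (hx : x ≠ v) (hS : 3 ≤ S.card) (hwv : w v = 0)
    (honly : ∀ y, s(v, y) ∈ s(v, x) ::ₘ s(v, x) ::ₘ K → y = v ∨ y = x)
    (hslack : Slack S (s(v, x) ::ₘ s(v, x) ::ₘ K) h s w)
    (hs : ∀ u ∈ S, u ≠ v → 4 + norm6 (h u + s u) ≤ cut (s(v, x) ::ₘ s(v, x) ::ₘ K) {u} + w u)
    (hv : h v + s v = 0 ∨ 6 + norm6 (h v + s v) ≤ cut (s(v, x) ::ₘ s(v, x) ::ₘ K) {v} + w v)
    (ih : SolvableBelow V (S.card + 2 * (s(v, x) ::ₘ s(v, x) ::ₘ K).card + ∑ v ∈ S, w v)) :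
    Solvable S (s(v, x) ::ₘ s(v, x) ::ₘ K) h := by
  have hends := ad.ends
  simp only [Multiset.forall_mem_cons, Sym2.ball] at hends
  obtain ⟨⟨hvS, hxS⟩, -, hends⟩ := hends
  obtain ⟨f, hf, hfh⟩ : Solvable S K h := by
    refine ih S _ h s w v ⟨hends, ?_, ad.sum_h, ad.norm_s, ad.parity_s, ad.top, ?_⟩ ?_
    · intro u hu
      obtain ⟨k, _, h2⟩ := exists_cut_parallel (v := v) (x := x) (K := K) {u}
      rw [ad.parity_h u hu, h2, Nat.cast_add, Nat.cast_mul, show ((2 : ℕ) : ZMod 2) = 0 from rfl,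
        zero_mul, add_zero]
    · refine degree_condition (fun u hu => ?_) fun A hA hA2 hAS => ?_
      · obtain ⟨k, _, h2⟩ := exists_cut_parallel (v := v) (x := x) (K := K) {u}
        rcases eq_or_ne u v with rfl | huv
        · rcases hv with hv | hv
          · exact Or.inl ⟨rfl, hv⟩
          · right; omega
        · right
          rcases eq_or_ne u x with rfl | hux
          -- The neighbour also loses two edges. All non-loop edges at `v` go to it, so its degree
          -- exceeds that of the pair by the degree of `v`, and the slack of the pair suffices.
          · have h3 := hslack {v, u} (by simp [Finset.insert_subset_iff, hvS, hu])
              (by rw [Finset.card_pair hx.symm]) (by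
                rintro rfl
                rw [Finset.card_pair hx.symm] at hS
                omega)
            rw [Finset.sum_pair hx.symm, Finset.sum_pair hx.symm] at h3
            have h4 := cut_add_le_of_parallel hx honly
            have h5 : norm6 (h u + s u) ≤ norm6 ((h v + s v) + (h u + s u)) + norm6 (h v + s v) := by
              rw [← norm6_neg (h v + s v)]
              exact norm6_le_of_eq_add (by ring)
            rcases hv with hv | hv
            · rw [hv, norm6_zero] at h5
              rw [hv] at h3
              omega
            · omega
          · have h1 := hs u hu huv
            simpa [cut_cons, huv.symm, hux.symm] using h1
      · have h1 := hslack A hA hA2 hAS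
        obtain ⟨k, _, h2⟩ := exists_cut_parallel (v := v) (x := x) (K := K) A
        omega
    · simp only [Multiset.card_cons]
      omega
  exact ⟨f, reach_parallel hf, hfh⟩

/-- Lifting an edge `vx` together with an oriented edge at `v`. -/
theorem solvable_of_lift_oriented (ad : Admissible S (s(v, x) ::ₘ K) h s w v₀)
    (hx : x ≠ v) (hwv : 0 < w v) (hslack : Slack S (s(v, x) ::ₘ K) h s w)
    (hs : ∀ u ∈ S, u ≠ v → 4 + norm6 (h u + s u) ≤ cut (s(v, x) ::ₘ K) {u} + w u)
    (hv : h v + s v = 0 ∨ 6 + norm6 (h v + s v) ≤ cut (s(v, x) ::ₘ K) {v} + w v)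
    (ih : SolvableBelow V (S.card + 2 * (s(v, x) ::ₘ K).card + ∑ v ∈ S, w v)) :
    Solvable S (s(v, x) ::ₘ K) h := by
  have hends := ad.ends
  simp only [Multiset.forall_mem_cons, Sym2.ball] at hends
  obtain ⟨⟨hvS, hxS⟩, hends⟩ := hends
  -- An additional edge of direction `a` is moved from `v` to `x`, and the edge `vx` is oriented so
  -- as to compensate. Thus `h + s` stays the same at every vertex.
  obtain ⟨a, ha, hna⟩ := exists_norm6_sub_lt (ad.norm_s v hvS) (ad.parity_s v hvS) hwv
  have hpa : parity a = 1 := by rcases ha with rfl | rfl <;> decide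
  have hna1 : norm6 a = 1 := by rcases ha with rfl | rfl <;> decide
  obtain ⟨g, hg⟩ : ∃ g : V → ZMod 6, g = Pi.single x a - Pi.single v a := ⟨_, rfl⟩
  have hge : g ∈ edgeBoundary s(v, x) := by
    rw [hg, Sym2.eq_swap]; exact single_sub_single_mem ha x v
  have hgx : g x = a := by simp [hg, hx]
  have hgv : g v = -a := by simp [hg, hx.symm]
  have hgu : ∀ u, u ≠ v → u ≠ x → g u = 0 := fun u h1 h2 => by simp [hg, h1, h2]
  have hgS : ∑ v ∈ S, g v = 0 := sum_eq_zero_of_mem hge (by simp [hvS, hxS])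
  obtain ⟨w', hw'⟩ : ∃ w' : V → ℕ, ∀ u, w' u + (Pi.single v 1 : V → ℕ) u =
      w u + (Pi.single x 1 : V → ℕ) u := by
    refine ⟨fun u => w u + (Pi.single x 1 : V → ℕ) u - (Pi.single v 1 : V → ℕ) u, fun u => ?_⟩
    refine Nat.sub_add_cancel ?_
    rcases eq_or_ne u v with rfl | huv
    · simp; omega
    · simp [huv]
  have hw'v : w' v + 1 = w v := by simpa [hx.symm] using hw' v
  have hw'x : w' x = w x + 1 := by simpa [hx] using hw' x
  have hw'u : ∀ u, u ≠ v → u ≠ x → w' u = w u := fun u h1 h2 => by simpa [h1, h2] using hw' u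
  have hw'S : ∑ u ∈ S, w' u = ∑ u ∈ S, w u := by simpa [hvS, hxS] using sum_shift hw' S
  have ht : ∀ u, (h - g) u + (s + g) u = h u + s u := fun u => by
    simp only [Pi.sub_apply, Pi.add_apply]; ring
  refine Solvable.cons hge (ih S K (h - g) (s + g) w' v ⟨hends,
    fun u hu => parity_sub_of_mem hge u (ad.parity_h u hu), ?_, ?_, ?_, ?_, ?_⟩ ?_)
  · simp only [Pi.sub_apply, Finset.sum_sub_distrib, ad.sum_h, hgS, sub_self]
  · intro u hu
    rw [Pi.add_apply]
    rcases eq_or_ne u v with rfl | huv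
    · rw [hgv, ← sub_eq_add_neg]; omega
    · rcases eq_or_ne u x with rfl | hux
      · rw [hgx, hw'x]
        exact (norm6_add_le _ _).trans (add_le_add (ad.norm_s u hu) hna1.le)
      · rw [hgu u huv hux, add_zero, hw'u u huv hux]
        exact ad.norm_s u hu
  · intro u hu
    rw [Pi.add_apply, map_add, ad.parity_s u hu]
    rcases eq_or_ne u v with rfl | huv
    · rw [hgv, ← hw'v, map_neg, hpa, Nat.cast_add, Nat.cast_one, add_neg_cancel_right]
    · rcases eq_or_ne u x with rfl | hux
      · rw [hgx, hw'x, hpa, Nat.cast_add, Nat.cast_one]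
      · rw [hgu u huv hux, hw'u u huv hux, map_zero, add_zero]
  · simp only [Pi.add_apply, Finset.sum_add_distrib, hgS, add_zero, hw'S]
    exact ad.top
  · simp only [ht]
    refine degree_condition (s := s) (h := h) (fun u hu => ?_) fun A hA hA2 hAS => ?_
    · rcases eq_or_ne u v with rfl | huv
      · rcases hv with hv | hv
        · exact Or.inl ⟨rfl, hv⟩
        · right
          rw [cut_cons] at hv
          split_ifs at hv <;> omega
      · right
        have h1 := hs u hu huv
        rcases eq_or_ne u x with rfl | hux
        · simp only [cut_cons, Finset.mem_singleton, hx.symm, iff_true, if_false] at h1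
          omega
        · simpa [cut_cons, huv.symm, hux.symm, hw'u u huv hux] using h1
    · have h1 := hslack A hA hA2 hAS
      have h2 := sum_shift hw' A
      rw [cut_cons] at h1
      split_ifs at h1 h2 <;> omega
  · rw [hw'S, Multiset.card_cons]
    omega

/-- A vertex of demand zero can become the exempt vertex and a vertex with slack two can afford to
lose two edges; in both cases a pair of edges at `v` is removed. -/
theorem solvable_of_liftable (ad : Admissible S H h s w v₀) (hvS : v ∈ S) (hS : 3 ≤ S.card)
    (hslack : Slack S H h s w)
    (hs : ∀ u ∈ S, u ≠ v → 4 + norm6 (h u + s u) ≤ cut H {u} + w u)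
    (hv : h v + s v = 0 ∨ 6 + norm6 (h v + s v) ≤ cut H {v} + w v)
    (ih : SolvableBelow V (S.card + 2 * H.card + ∑ v ∈ S, w v)) : Solvable S H h := by
  rcases Nat.eq_zero_or_pos (cut H {v}) with h0 | h0
  · exfalso
    -- If no edge of `H` leaves `v`, only additional edges leave the other vertices, and the slack
    -- of that set contradicts `top`.
    have h1 := hslack (S \ {v}) Finset.sdiff_subset
      (by rw [Finset.card_sdiff_of_subset (by simpa using hvS), Finset.card_singleton]; omega)
      (by simpa using hvS)
    rw [cut_sdiff ad.ends, h0] at h1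
    have h2 := Finset.sum_sdiff (f := w) (Finset.singleton_subset_iff.2 hvS)
    have h3 := Finset.sum_sdiff (f := fun v => h v + s v) (Finset.singleton_subset_iff.2 hvS)
    rw [Finset.sum_singleton] at h2 h3
    have h4 := ad.top
    rw [Finset.sum_add_distrib (s := S), ad.sum_h, zero_add] at h3
    rw [← h3] at h4
    have h5 := norm6_add_le (∑ v ∈ S \ {v}, (h v + s v)) (h v + s v)
    rcases hv with hv | hv
    · have h6 : norm6 (h v + s v) = 0 := by rw [hv, norm6_zero]
      omega
    · omega
  · obtain ⟨x, hx, K, rfl⟩ := exists_cons_of_cut_singleton_pos h0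
    rcases Nat.eq_zero_or_pos (w v) with hw | hw
    · by_cases hy : ∃ y, s(v, y) ∈ K ∧ y ≠ v ∧ y ≠ x
      · obtain ⟨y, hyK, hyv, hyx⟩ := hy
        obtain ⟨K, rfl⟩ := Multiset.exists_cons_of_mem hyK
        exact ad.solvable_of_lift hx hyv hyx.symm hslack hs hv ih
      · push Not at hy
        -- There is a second edge at `v`: the degree is even if the demand is zero, and at least six
        -- otherwise.
        have h1 : 0 < cut K {v} := by
          have h2 : cut (s(v, x) ::ₘ K) {v} = cut K {v} + 1 := by simp [cut_cons, hx]
          rcases hv with hv | hv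
          · have h3 := ad.parity_sum (Finset.singleton_subset_iff.2 hvS)
            simp only [Finset.sum_singleton, hv, hw, h2, map_zero, add_zero] at h3
            by_contra h4
            rw [show cut K {v} = 0 by omega] at h3
            exact absurd h3 (by decide)
          · omega
        obtain ⟨y, hyv, K, rfl⟩ := exists_cons_of_cut_singleton_pos h1
        obtain rfl := hy y (by simp) hyv
        refine ad.solvable_of_parallel hx hS hw (fun z hz => ?_) hslack hs hv ih
        rcases Multiset.mem_cons.1 hz with hz | hz
        · right
          rcases Sym2.eq_iff.1 hz with ⟨_, h1⟩ | ⟨h1, _⟩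
          · exact h1
          · exact absurd h1.symm hx
        · by_contra h2
          push Not at h2
          exact h2.2 (hy z hz h2.1)
    · exact ad.solvable_of_lift_oriented hx hw hslack hs hv ih

end Admissible

end EdgeMultiset

namespace EdgeMultiset

variable {V : Type*} [DecidableEq V] {S : Finset V} {K H : Multiset (Sym2 V)} {h s : V → ZMod 6}
  {w : V → ℕ} {v₀ v x y : V}

/-! ### Orienting edges and the proof of the extension theorem -/

namespace Admissible

theorem slack [Fintype V] (ad : Admissible S H h s w v₀)
    (ih : SolvableBelow V (S.card + 2 * H.card + ∑ v ∈ S, w v)) (hn : ¬Solvable S H h) :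
    Slack S H h s w := by
  intro A hA hA2 hAS
  by_contra hlt
  refine hn (ad.of_tight hA hAS hA2 ?_ ih)
  obtain ⟨k, hk⟩ := even_norm6_add (ad.parity_sum hA)
  omega

/-- Orienting an edge from `x` to `y` if this is in accordance with the demands of both ends. -/
theorem solvable_of_orient (ad : Admissible S (s(x, y) ::ₘ K) h s w v₀) (hxy : x ≠ y)
    (hslack : Slack S (s(x, y) ::ₘ K) h s w)
    (hs : ∀ u ∈ S, 4 + norm6 (h u + s u) ≤ cut (s(x, y) ::ₘ K) {u} + w u)
    (hx : norm6 (h x + s x - 1) + 1 ≤ norm6 (h x + s x))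
    (hy : norm6 (h y + s y + 1) + 1 ≤ norm6 (h y + s y))
    (ih : SolvableBelow V (S.card + 2 * (s(x, y) ::ₘ K).card + ∑ v ∈ S, w v)) :
    Solvable S (s(x, y) ::ₘ K) h := by
  have hends := ad.ends
  simp only [Multiset.forall_mem_cons, Sym2.ball] at hends
  obtain ⟨⟨hxS, hyS⟩, hends⟩ := hends
  have hge := single_sub_single_mem (a := 1) (Or.inl rfl) x y
  refine Solvable.cons hge (ih S K _ s w v₀ ⟨hends,
    fun u hu => parity_sub_of_mem hge u (ad.parity_h u hu), ?_, ad.norm_s, ad.parity_s, ad.top, ?_⟩ ?_)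
  · simp only [Pi.sub_apply, Finset.sum_sub_distrib, ad.sum_h, sum_single, hxS, hyS, if_true,
      sub_self]
  · refine degree_condition (fun u hu => Or.inr ?_) fun A hA hA2 hAS => ?_
    · have h1 := hs u hu
      rcases eq_or_ne u x with rfl | hux
      · have h2 : (h - (Pi.single u 1 - Pi.single y 1) : V → ZMod 6) u + s u = h u + s u - 1 := by
          simp [hxy]; ring
        have h3 : cut (s(u, y) ::ₘ K) {u} = cut K {u} + 1 := by simp [cut_cons, hxy.symm]
        rw [h2]; omega
      · rcases eq_or_ne u y with rfl | huy
        · have h2 : (h - (Pi.single x 1 - Pi.single u 1) : V → ZMod 6) u + s u = h u + s u + 1 := by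
            simp [hxy.symm]; ring
          have h3 : cut (s(x, u) ::ₘ K) {u} = cut K {u} + 1 := by simp [cut_cons, hxy]
          rw [h2]; omega
        · simpa [cut_cons, hux, huy, hux.symm, huy.symm] using h1
    · have h1 := hslack A hA hA2 hAS
      simp only [Pi.sub_apply, Finset.sum_sub_distrib, Finset.sum_add_distrib, sum_single,
        cut_cons] at h1 ⊢
      have n1 : norm6 1 = 1 := by decide
      by_cases hxA : x ∈ A <;> by_cases hyA : y ∈ A <;> simp only [hxA, hyA, if_true, if_false,
        iff_false, iff_true, not_true, sub_zero, sub_self, zero_sub] at h1 ⊢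
      · omega
      · have := norm6_sub_le (∑ x ∈ A, h x + ∑ x ∈ A, s x) 1
        rw [add_sub_right_comm] at this
        omega
      · have := norm6_add_le (∑ x ∈ A, h x + ∑ x ∈ A, s x) 1
        rw [add_right_comm] at this
        rw [sub_neg_eq_add]
        omega
      · omega
  · rw [Multiset.card_cons]
    omega

/-- Deleting an oriented edge in accordance with the demand of its end. -/
theorem solvable_of_delete_oriented (ad : Admissible S H h s w v₀) (hxS : x ∈ S)
    (hslack : Slack S H h s w)
    (hs : ∀ u ∈ S, 4 + norm6 (h u + s u) ≤ cut H {u} + w u)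
    (hx : norm6 (h x + s x - 1) + 1 ≤ norm6 (h x + s x))
    (hsx : norm6 (s x - 1) + 1 ≤ w x)
    (ih : SolvableBelow V (S.card + 2 * H.card + ∑ v ∈ S, w v)) :
    Solvable S H h := by
  obtain ⟨w', rfl⟩ : ∃ w' : V → ℕ, w = w' + Pi.single x 1 := by
    refine ⟨fun u => w u - (Pi.single x 1 : V → ℕ) u, funext fun u => ?_⟩
    rcases eq_or_ne u x with rfl | hux
    · simp; omega
    · simp [hux]
  have htop := ad.top
  have n1 : norm6 1 = 1 := by decide
  simp only [Pi.add_apply, Finset.sum_add_distrib, sum_single, hxS, if_true, Pi.single_eq_same]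
    at htop hsx ih
  refine ih S H h (s - Pi.single x 1) w' v₀ ⟨ad.ends, ad.parity_h, ad.sum_h, ?_, ?_, ?_, ?_⟩
    (by omega)
  · intro u hu
    rcases eq_or_ne u x with rfl | hux
    · simp; omega
    · simpa [hux] using ad.norm_s u hu
  · intro u hu
    have := ad.parity_s u hu
    rcases eq_or_ne u x with rfl | hux
    · simp [this]
    · simpa [hux] using this
  · simp only [Pi.sub_apply, Finset.sum_sub_distrib, sum_single, hxS, if_true]
    have := norm6_le_of_eq_add (a := ∑ v ∈ S, s v - 1) (b := 1) (sub_add_cancel _ _).symm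
    omega
  · refine degree_condition (fun u hu => Or.inr ?_) fun A hA hA2 hAS => ?_
    · have h1 := hs u hu
      rcases eq_or_ne u x with rfl | hux
      · simp only [Pi.sub_apply, Pi.single_eq_same, Pi.add_apply] at h1 ⊢
        rw [← add_sub_assoc]
        omega
      · simpa [hux] using h1
    · have h1 := hslack A hA hA2 hAS
      simp only [Pi.sub_apply, Pi.add_apply, Finset.sum_sub_distrib, Finset.sum_add_distrib,
        sum_single] at h1 ⊢
      by_cases hxA : x ∈ A <;> simp only [hxA, if_true, if_false, sub_zero, add_zero] at h1 ⊢
      · have := norm6_sub_le (∑ x ∈ A, h x + ∑ x ∈ A, s x) 1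
        rw [add_sub_assoc] at this
        omega
      · omega

/-- If all oriented edges at `x` are opposite to its demand, one of them is replaced by two edges in
the other direction, and an edge of `H` is oriented towards `x`. -/
theorem solvable_of_double (ad : Admissible S (s(x, y) ::ₘ K) h s w v₀) (hxy : x ≠ y)
    (hslack : Slack S (s(x, y) ::ₘ K) h s w)
    (hs : ∀ u ∈ S, 4 + norm6 (h u + s u) ≤ cut (s(x, y) ::ₘ K) {u} + w u)
    (hx : h x + s x = 1 ∨ h x + s x = 2)
    (hy : norm6 (h y + s y - 1) + 1 ≤ norm6 (h y + s y))
    (hsx : norm6 (s x + 3) ≤ w x + 1)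
    (htop : ∑ v ∈ S, w v + 1 ≤ 4 + norm6 (∑ v ∈ S, s v + 3))
    (ih : SolvableBelow V (S.card + 2 * (s(x, y) ::ₘ K).card + ∑ v ∈ S, w v)) :
    Solvable S (s(x, y) ::ₘ K) h := by
  have hends := ad.ends
  simp only [Multiset.forall_mem_cons, Sym2.ball] at hends
  obtain ⟨⟨hxS, hyS⟩, hends⟩ := hends
  have hge := single_sub_single_mem (a := 1) (Or.inl rfl) y x
  rw [Sym2.eq_swap] at hge
  refine Solvable.cons hge (ih S K _ (s + Pi.single x 3) (w + Pi.single x 1) v₀ ⟨hends,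
    fun u hu => parity_sub_of_mem hge u (ad.parity_h u hu), ?_, ?_, ?_, ?_, ?_⟩ ?_)
  · simp only [Pi.sub_apply, Finset.sum_sub_distrib, ad.sum_h, sum_single, hxS, hyS, if_true,
      sub_self]
  · intro u hu
    rcases eq_or_ne u x with rfl | hux
    · simpa using hsx
    · simpa [hux] using ad.norm_s u hu
  · intro u hu
    have := ad.parity_s u hu
    rcases eq_or_ne u x with rfl | hux
    · simp only [Pi.add_apply, Pi.single_eq_same, map_add, this, Nat.cast_add, Nat.cast_one]
      rfl
    · simpa [hux] using this
  · simpa only [Pi.add_apply, Finset.sum_add_distrib, sum_single, hxS, if_true] using htop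
  · refine degree_condition (fun u hu => Or.inr ?_) fun A hA hA2 hAS => ?_
    · have h1 := hs u hu
      rcases eq_or_ne u x with rfl | hux
      · have h2 : (h - (Pi.single y 1 - Pi.single u 1) : V → ZMod 6) u + (s + Pi.single u 3 : V → ZMod 6) u =
            h u + s u + 4 := by
          simp [hxy]; ring
        have h3 : cut (s(u, y) ::ₘ K) {u} = cut K {u} + 1 := by simp [cut_cons, hxy.symm]
        have h4 : norm6 (h u + s u + 4) ≤ norm6 (h u + s u) := by
          rcases hx with hx | hx <;> rw [hx] <;> decide
        rw [h2, Pi.add_apply, Pi.single_eq_same]; omega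
      · rcases eq_or_ne u y with rfl | huy
        · have h2 : (h - (Pi.single u 1 - Pi.single x 1) : V → ZMod 6) u + (s + Pi.single x 3 : V → ZMod 6) u =
              h u + s u - 1 := by
            simp [hxy.symm]; ring
          have h3 : cut (s(x, u) ::ₘ K) {u} = cut K {u} + 1 := by simp [cut_cons, hxy]
          rw [h2, Pi.add_apply, Pi.single_eq_of_ne hux]; omega
        · simpa [cut_cons, hux, huy, hux.symm, huy.symm] using h1
    · have h1 := hslack A hA hA2 hAS
      simp only [Pi.sub_apply, Pi.add_apply, Finset.sum_sub_distrib, Finset.sum_add_distrib,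
        sum_single, cut_cons] at h1 ⊢
      generalize ∑ x ∈ A, h x = a at *
      generalize ∑ x ∈ A, s x = b at *
      by_cases hxA : x ∈ A <;> by_cases hyA : y ∈ A <;> simp only [hxA, hyA, if_true, if_false,
        iff_false, iff_true, not_true, sub_zero, sub_self, zero_sub, add_zero] at h1 ⊢
      · have := norm6_le_of_eq_add (a := a + b) (b := 3) (c := a + (b + 3)) (by ring)
        have n3 : norm6 3 = 3 := by decide
        omega
      · have := norm6_le_of_eq_add (a := a + b) (b := -2) (c := a - -1 + (b + 3))
          (by rw [show (-2 : ZMod 6) = 4 by decide]; ring)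
        have n2 : norm6 (-2) = 2 := by decide
        omega
      · have := norm6_le_of_eq_add (a := a + b) (b := -1) (c := a - 1 + b) (by ring)
        have n2 : norm6 (-1) = 1 := by decide
        omega
      · omega
  · simp only [Multiset.card_cons, Pi.add_apply, Finset.sum_add_distrib, sum_single, hxS, if_true]
    omega

/-- Every vertex wants outgoing edges. An additional edge directed away from its end can be deleted;
if all of them point the wrong way, one is doubled and reversed, which changes the net flow by
three. -/
theorem solvable_of_pos (ad : Admissible S H h s w v₀) (hS : 3 ≤ S.card) (hslack : Slack S H h s w)
    (hcut : ∀ u ∈ S, 0 < cut H {u}) (hs : ∀ u ∈ S, 4 + norm6 (h u + s u) = cut H {u} + w u)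
    (hpos : ∀ u ∈ S, h u + s u = 1 ∨ h u + s u = 2)
    (ih : SolvableBelow V (S.card + 2 * H.card + ∑ v ∈ S, w v)) : Solvable S H h := by
  have hpos' : ∀ u ∈ S, norm6 (h u + s u - 1) + 1 ≤ norm6 (h u + s u) := fun u hu => by
    rcases hpos u hu with e | e <;> rw [e] <;> decide
  by_cases hd : ∃ x ∈ S, norm6 (s x - 1) + 1 ≤ w x
  · obtain ⟨x, hxS, hx⟩ := hd
    exact ad.solvable_of_delete_oriented hxS hslack (fun u hu => (hs u hu).le) (hpos' x hxS) hx ih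
  push Not at hd
  -- No additional edge at `u` can be taken as outgoing, so there are at most three and all count as
  -- incoming.
  have hneg : ∀ u ∈ S, s u = -(w u : ZMod 6) ∧ norm6 (s u + 3) ≤ w u + 1 ∨ w u = 0 ∧ s u = 0 := by
    intro u hu
    have h1 := ad.norm_s u hu
    rcases Nat.eq_zero_or_pos (w u) with h0 | h0
    · right
      rw [h0, Nat.le_zero, norm6_eq_zero] at h1
      exact ⟨h0, h1⟩
    · left
      have h2 := hd u hu
      have h3 := ad.parity_s u hu
      have h4 : w u < 4 := by have := norm6_le_three (s u - 1); omega
      have key : ∀ n : Fin 4, ∀ a : ZMod 6, norm6 a ≤ n → (n : ℕ) < norm6 (a - 1) + 1 →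
          parity a = ((n : ℕ) : ZMod 2) → 0 < (n : ℕ) →
          a = -((n : ℕ) : ZMod 6) ∧ norm6 (a + 3) ≤ n + 1 := by decide
      exact key ⟨w u, h4⟩ (s u) h1 h2 h3 h0
  by_cases hw : ∃ x ∈ S, 0 < w x
  · obtain ⟨x, hxS, hx⟩ := hw
    obtain ⟨y, hyx, K, rfl⟩ := exists_cons_of_cut_singleton_pos (hcut x hxS)
    have hyS : y ∈ S := ad.ends s(x, y) (by simp) y (by simp)
    refine ad.solvable_of_double hyx.symm hslack (fun u hu => (hs u hu).le) (hpos x hxS)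
      (hpos' y hyS) ?_ ?_ ih
    · rcases hneg x hxS with h1 | h1
      · exact h1.2
      · omega
    -- All additional edges count with the same sign, and there are at most 4 + 3 = 7 of them, so
    -- the bound after the change is a finite check.
    · have h1 : ∑ u ∈ S, s u = -((∑ u ∈ S, w u : ℕ) : ZMod 6) := by
        rw [Nat.cast_sum, ← Finset.sum_neg_distrib]
        refine Finset.sum_congr rfl fun u hu => ?_
        rcases hneg u hu with h1 | h1
        · exact h1.1
        · rw [h1.1, h1.2, Nat.cast_zero, neg_zero]
      have h2 := ad.top
      rw [h1] at h2 ⊢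
      have h3 := norm6_le_three (-((∑ u ∈ S, w u : ℕ) : ZMod 6))
      generalize ∑ u ∈ S, w u = W at *
      have key : ∀ n : Fin 8, (n : ℕ) ≤ 4 + norm6 (-((n : ℕ) : ZMod 6)) →
        (n : ℕ) + 1 ≤ 4 + norm6 (-((n : ℕ) : ZMod 6) + 3) := by decide
      exact key ⟨W, by omega⟩ h2
  · push Not at hw
    obtain ⟨x, hxS⟩ : S.Nonempty := Finset.card_pos.1 (by omega)
    -- Without additional edges, a vertex and its complement in `S` have the same cut and the same
    -- norm of demand; the former has equality in the degree condition and the latter has slack.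
    exfalso
    have h1 := hslack (S \ {x}) Finset.sdiff_subset
      (by rw [Finset.card_sdiff_of_subset (by simpa using hxS), Finset.card_singleton]; omega)
      (by simpa using hxS)
    rw [cut_sdiff ad.ends] at h1
    have hw0 : ∀ u ∈ S, w u = 0 := fun u hu => Nat.le_zero.1 (hw u hu)
    have hs0 : ∀ u ∈ S, s u = 0 := fun u hu => by
      have := ad.norm_s u hu
      rwa [hw0 u hu, Nat.le_zero, norm6_eq_zero] at this
    have h2 : ∑ u ∈ S \ {x}, w u = 0 :=
      Finset.sum_eq_zero fun u hu => hw0 u (Finset.mem_sdiff.1 hu).1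
    have h3 := Finset.sum_sdiff (f := fun v => h v + s v) (Finset.singleton_subset_iff.2 hxS)
    rw [Finset.sum_singleton, Finset.sum_add_distrib (s := S), ad.sum_h, Finset.sum_eq_zero hs0,
      add_zero] at h3
    have h4 : norm6 (h x + s x) = norm6 (∑ u ∈ S \ {x}, (h u + s u)) := by
      rw [eq_neg_of_add_eq_zero_left h3, norm6_neg]
    have h5 := hs x hxS
    rw [hw0 x hxS] at h5
    omega

/-- In a minimal counterexample no reduction applies, so all demands are nonzero and every single
vertex is tight. Since `H` is connected and no edge can be oriented to suit both ends, all demands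
have the same sign. -/
theorem solvable [Fintype V] (ad : Admissible S H h s w v₀) : Solvable S H h := by
  induction hn : S.card + 2 * H.card + ∑ v ∈ S, w v using Nat.strong_induction_on
    generalizing S H h s w v₀ with
  | _ n ih =>
  subst hn
  replace ih : SolvableBelow V (S.card + 2 * H.card + ∑ v ∈ S, w v) :=
    fun S' H' h' s' w' v₀' ad' hlt => ih _ hlt ad' rfl
  rcases Nat.lt_or_ge S.card 3 with hS | hS
  · rcases Nat.lt_or_ge S.card 2 with h2 | h2
    · exact solvable_of_card_le_one ad.ends ad.sum_h (by omega)
    · exact ad.solvable_of_card_eq_two (by omega)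
  by_contra hns
  have hslack := ad.slack ih hns
  have hsingle : ∀ u ∈ S, (u = v₀ ∧ h v₀ + s v₀ = 0) ∨
      4 + norm6 (h u + s u) ≤ cut H {u} + w u := by
    intro u hu
    have := ad.cond {u} (by simpa using hu) (by simp) (by rintro rfl; simp at hS)
    simpa using this
  have hs : ∀ u ∈ S, 4 + norm6 (h u + s u) ≤ cut H {u} + w u := by
    intro u hu
    rcases hsingle u hu with ⟨rfl, h0⟩ | h1
    · refine absurd (ad.solvable_of_liftable hu hS hslack (fun v hv hvu => ?_) (Or.inl h0) ih) hns
      exact (hsingle v hv).resolve_left fun h1 => hvu h1.1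
    · exact h1
  have hlift : ∀ v ∈ S, ¬(h v + s v = 0 ∨ 6 + norm6 (h v + s v) ≤ cut H {v} + w v) :=
    fun v hv hl => hns (ad.solvable_of_liftable hv hS hslack (fun u hu _ => hs u hu) hl ih)
  have hs' : ∀ u ∈ S, 4 + norm6 (h u + s u) = cut H {u} + w u := by
    intro u hu
    have h1 := hs u hu
    have h2 := (not_or.1 (hlift u hu)).2
    obtain ⟨k, hk⟩ := even_norm6_add (ad.parity_sum (Finset.singleton_subset_iff.2 hu))
    simp only [Finset.sum_singleton] at hk
    omega
  have hcond : ∀ A ⊆ S, A.Nonempty → A ≠ S →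
      4 + norm6 (∑ v ∈ A, (h v + s v)) ≤ cut H A + ∑ v ∈ A, w v := by
    intro A hA hne hAS
    rcases ad.cond A hA hne hAS with ⟨rfl, h1⟩ | h1
    · simpa using hs v₀ (by simpa using hA)
    · exact h1
  -- The conditions for `A` and `S \ A` add up to at least eight plus the norms, while `top` allows
  -- only four plus the norms for the additional edges.
  have hconn : ∀ A ⊆ S, A.Nonempty → A ≠ S → 0 < cut H A := by
    intro A hA hne hAS
    by_contra h0
    have h1 := hcond A hA hne hAS
    have h2 := hcond (S \ A) Finset.sdiff_subset
      (Finset.sdiff_nonempty.2 fun h => hAS (hA.antisymm h))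
      (fun h => hne.ne_empty (by
        have := Finset.sdiff_eq_self_iff_disjoint.1 h
        rw [← Finset.inter_eq_right.2 hA]; exact Finset.disjoint_iff_inter_eq_empty.1 this))
    rw [cut_sdiff ad.ends] at h2
    have h3 := Finset.sum_sdiff (f := w) hA
    have h4 := Finset.sum_sdiff (f := fun v => h v + s v) hA
    have h5 := ad.top
    rw [Finset.sum_add_distrib (s := S), ad.sum_h, zero_add] at h4
    rw [← h4] at h5
    have h6 := norm6_add_le (∑ v ∈ S \ A, (h v + s v)) (∑ v ∈ A, (h v + s v))
    omega
  have hcut : ∀ u ∈ S, 0 < cut H {u} := fun u hu =>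
    hconn {u} (by simpa using hu) (by simp) (by rintro rfl; simp at hS)
  have horient : ∀ x y, s(x, y) ∈ H → x ≠ y → norm6 (h x + s x - 1) + 1 ≤ norm6 (h x + s x) →
      ¬norm6 (h y + s y + 1) + 1 ≤ norm6 (h y + s y) := by
    intro x y hxy hne hx hy
    obtain ⟨K, rfl⟩ := Multiset.exists_cons_of_mem hxy
    exact hns (ad.solvable_of_orient hne hslack hs hx hy ih)
  have hsign : ∀ a : ZMod 6, a ≠ 0 → norm6 (a - 1) + 1 ≤ norm6 a ∨ norm6 (a + 1) + 1 ≤ norm6 a := by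
    decide
  have hne0 : ∀ u ∈ S, h u + s u ≠ 0 := fun u hu => (not_or.1 (hlift u hu)).1
  have hnbr : ∀ u ∈ S, ∃ v ∈ S, v ≠ u ∧ s(u, v) ∈ H := by
    intro u hu
    obtain ⟨v, hvu, K, rfl⟩ := exists_cons_of_cut_singleton_pos (hcut u hu)
    exact ⟨v, ad.ends s(u, v) (by simp) v (by simp), hvu, by simp⟩
  -- These are the vertices with demand 1, 2 or 3. Demand 3 is also reduced by an incoming edge, so
  -- it is excluded once every vertex lies in `P`.
  set P := S.filter (fun u => norm6 (h u + s u - 1) + 1 ≤ norm6 (h u + s u)) with hP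
  have hPS : P ⊆ S := Finset.filter_subset _ _
  by_cases hP0 : P.Nonempty
  · by_cases hP1 : P = S
    · refine hns (ad.solvable_of_pos hS hslack hcut hs' (fun u hu => ?_) ih)
      have hpos : ∀ u ∈ S, norm6 (h u + s u - 1) + 1 ≤ norm6 (h u + s u) := fun u hu => by
        rw [← hP1] at hu; exact (Finset.mem_filter.1 hu).2
      obtain ⟨v, hv, hvu, he⟩ := hnbr u hu
      have h1 := horient v u (by rwa [Sym2.eq_swap]) hvu (hpos v hv)
      have key : ∀ a : ZMod 6, norm6 (a - 1) + 1 ≤ norm6 a → ¬norm6 (a + 1) + 1 ≤ norm6 a →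
          a = 1 ∨ a = 2 := by decide
      exact key _ (hpos u hu) h1
    · obtain ⟨e, he, x, y, hx, hy, rfl⟩ := exists_crosses_of_cut_pos (hconn P hPS hP0 hP1)
      have hyS := ad.ends _ he y (by simp)
      have hy' : ¬norm6 (h y + s y - 1) + 1 ≤ norm6 (h y + s y) := fun h1 =>
        hy (Finset.mem_filter.2 ⟨hyS, h1⟩)
      refine horient x y he ?_ (Finset.mem_filter.1 hx).2 ((hsign _ (hne0 y hyS)).resolve_left hy')
      rintro rfl
      exact hy hx
  · have hneg : ∀ u ∈ S, ¬norm6 (h u + s u - 1) + 1 ≤ norm6 (h u + s u) := fun u hu h1 =>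
      hP0 ⟨u, Finset.mem_filter.2 ⟨hu, h1⟩⟩
    have hslack' : Slack S H (-h) (-s) w := by
      intro A hA hA2 hAS
      have h1 : ∑ v ∈ A, ((-h) v + (-s) v) = -∑ v ∈ A, (h v + s v) := by
        rw [← Finset.sum_neg_distrib]
        exact Finset.sum_congr rfl fun v _ => by simp only [Pi.neg_apply]; ring
      rw [h1, norm6_neg]
      exact hslack A hA hA2 hAS
    have ht : ∀ u, (-h) u + (-s) u = -(h u + s u) := fun u => by
      simp only [Pi.neg_apply]; ring
    obtain ⟨f, hf, hfh⟩ := ad.neg.solvable_of_pos hS hslack' hcut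
      (fun u hu => by rw [ht, norm6_neg]; exact hs' u hu)
      (fun u hu => by
        rw [ht]
        have key : ∀ a : ZMod 6, a ≠ 0 → ¬norm6 (a - 1) + 1 ≤ norm6 a → -a = 1 ∨ -a = 2 := by
          decide
        exact key _ (hne0 u hu) (hneg u hu)) ih
    exact hns ⟨-f, neg_mem_reach hf, fun v hv => by rw [Pi.neg_apply, hfh v hv, Pi.neg_apply, neg_neg]⟩

end Admissible

end EdgeMultiset

namespace EdgeMultiset

variable {V : Type*}

/-! ### Packings of four connected spanning subgraphs -/

/-- The edges of `K` connect the vertices in `S`. -/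
def Connects (S : Finset V) (K : Multiset (Sym2 V)) : Prop :=
  ∀ A ⊆ S, A.Nonempty → A ≠ S → 0 < cut K A

theorem inside_add (H K : Multiset (Sym2 V)) (A : Finset V) :
    inside (H + K) A = inside H A + inside K A := by
  classical
  exact Multiset.filter_add _ _ _

theorem inside_sum (K : Fin 4 → Multiset (Sym2 V)) (A : Finset V) :
    inside (∑ i, K i) A = ∑ i, inside (K i) A := by
  simp only [Fin.sum_univ_four, inside_add]

theorem cut_sum (K : Fin 4 → Multiset (Sym2 V)) (A : Finset V) :
    cut (∑ i, K i) A = ∑ i, cut (K i) A := by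
  simp only [Fin.sum_univ_four, cut_add]

variable [DecidableEq V] {S A B : Finset V} {K H : Multiset (Sym2 V)} {h : V → ZMod 6}

theorem Connects.contraction {p : V → V} (hK : Connects S K) (hends : ∀ e ∈ K, ∀ v ∈ e, v ∈ S) :
    Connects (S.image p) (K.map (Sym2.map p)) := by
  intro B hB hne hBS
  obtain ⟨h1, h2⟩ := filter_contraction hB hne hBS
  rw [cut_map p hends]
  exact hK _ (Finset.filter_subset _ _) h1 h2

theorem cut_inside_sdiff (B : Finset V) : cut (inside K A) (A \ B) = cut (inside K A) B :=
  cut_sdiff fun _ he => (mem_inside.1 he).2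

/-- If no edge inside `A` leaves `B ⊆ A`, then an edge leaves both `B` and `A`. -/
theorem Connects.exists_of_cut_inside {V : Type*} {S A B : Finset V} {K : Multiset (Sym2 V)}
    (hK : Connects S K) (hAS : A ⊆ S) (hBA : B ⊆ A)
    (hB : B.Nonempty) (hBne : B ≠ A) (h0 : cut (inside K A) B = 0) :
    ∃ x ∈ B, ∃ y, y ∉ A ∧ s(x, y) ∈ K := by
  obtain ⟨e, he, x, y, hx, hy, rfl⟩ := exists_crosses_of_cut_pos
    (hK B (hBA.trans hAS) hB fun h => hBne (hBA.antisymm (h ▸ hAS)))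
  refine ⟨x, hx, y, fun hyA => ?_, he⟩
  have h1 : s(x, y) ∈ inside K A := mem_inside.2 ⟨he, by simp [hBA hx, hyA]⟩
  exact (cut_pos h1 ⟨x, y, hx, hy, rfl⟩).ne' h0

/-- If `A` falls apart into `B` and `A \ B`, each part must have its own edge leaving `A`. -/
theorem Connects.exists_pair_of_cut_inside (hK : Connects S K) (hAS : A ⊆ S) (hBA : B ⊆ A)
    (hB : B.Nonempty) (hBne : B ≠ A) (h0 : cut (inside K A) B = 0) :
    ∃ x ∈ B, ∃ y, y ∉ A ∧ ∃ x' ∈ A \ B, ∃ y', y' ∉ A ∧ ∃ L, K = s(x, y) ::ₘ s(x', y') ::ₘ L := by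
  obtain ⟨x, hx, y, hy, hxy⟩ := hK.exists_of_cut_inside hAS hBA hB hBne h0
  obtain ⟨x', hx', y', hy', hxy'⟩ := hK.exists_of_cut_inside (B := A \ B) hAS Finset.sdiff_subset
    (Finset.sdiff_nonempty.2 fun h => hBne (hBA.antisymm h))
    (fun h => by
      obtain ⟨b, hb⟩ := hB
      have := hBA hb
      rw [← h] at this
      exact (Finset.mem_sdiff.1 this).2 hb)
    (by rw [cut_inside_sdiff, h0])
  obtain ⟨L, rfl⟩ := Multiset.exists_cons_of_mem hxy
  have hne : s(x', y') ≠ s(x, y) := by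
    intro h
    rcases Sym2.eq_iff.1 h with ⟨rfl, _⟩ | ⟨rfl, _⟩
    · exact (Finset.mem_sdiff.1 hx').2 hx
    · exact hy (Finset.mem_sdiff.1 hx').1
  obtain ⟨L, rfl⟩ := Multiset.exists_cons_of_mem
    ((Multiset.mem_cons.1 hxy').resolve_left hne)
  exact ⟨x, hx, y, hy, x', hx', y', hy', L, rfl⟩

theorem Connects.inside_of_cut_le_one (hK : Connects S K) (hAS : A ⊆ S) (hcut : cut K A ≤ 1) :
    Connects A (inside K A) := by
  intro B hBA hB hBne
  by_contra h0
  obtain ⟨x, hx, y, hy, x', hx', y', hy', L, rfl⟩ :=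
    hK.exists_pair_of_cut_inside hAS hBA hB hBne (by omega)
  simp only [cut_cons, hBA hx, hy, (Finset.mem_sdiff.1 hx').1, hy', iff_false, not_true,
    if_false] at hcut
  omega

/-- A cut with at most two edges leaves one of the two sides connected. -/
theorem Connects.inside_or_inside (hK : Connects S K) (hends : ∀ e ∈ K, ∀ v ∈ e, v ∈ S)
    (hAS : A ⊆ S) (hcut : cut K A ≤ 2) :
    Connects A (inside K A) ∨ Connects (S \ A) (inside K (S \ A)) := by
  by_contra hcon
  simp only [Connects, not_or, not_forall] at hcon
  obtain ⟨⟨B, hBA, hB, hBne, h0⟩, C, hCA, hC, hCne, h0'⟩ := hcon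
  obtain ⟨x, hx, y, hy, x', hx', y', hy', L, rfl⟩ :=
    hK.exists_pair_of_cut_inside hAS hBA hB hBne (by omega)
  have hx'A := (Finset.mem_sdiff.1 hx').1
  have hx'B := (Finset.mem_sdiff.1 hx').2
  have hxA := hBA hx
  have hL : cut L A = 0 := by
    simp only [cut_cons, hxA, hy, hx'A, hy', iff_false, not_true, if_false] at hcut
    omega
  have hmem : ∀ z u, z ∈ S \ A → u ∉ S \ A → s(z, u) ∈ s(x, y) ::ₘ s(x', y') ::ₘ L →
      z = y ∨ z = y' := by
    intro z u hz hu he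
    have huS := hends _ he u (by simp)
    have huA : u ∈ A := by by_contra h; exact hu (Finset.mem_sdiff.2 ⟨huS, h⟩)
    have hzA := (Finset.mem_sdiff.1 hz).2
    rcases Multiset.mem_cons.1 he with he | he
    · rcases Sym2.eq_iff.1 he with ⟨rfl, _⟩ | ⟨rfl, _⟩
      · exact absurd hxA hzA
      · exact Or.inl rfl
    · rcases Multiset.mem_cons.1 he with he | he
      · rcases Sym2.eq_iff.1 he with ⟨rfl, _⟩ | ⟨rfl, _⟩
        · exact absurd hx'A hzA
        · exact Or.inr rfl
      · exact absurd hL (cut_pos he ⟨u, z, huA, hzA, Sym2.eq_swap⟩).ne'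
  -- No edge would leave `B ∪ D`: of the two edges across the cut, `xy` lies within it and `x'y'`
  -- outside it.
  have hfinal : ∀ D, D ⊆ S \ A → cut (inside (s(x, y) ::ₘ s(x', y') ::ₘ L) (S \ A)) D = 0 →
      y ∈ D → y' ∉ D → False := by
    intro D hD hD0 hyD hy'D
    have hpos := hK (B ∪ D) (Finset.union_subset (hBA.trans hAS) (hD.trans Finset.sdiff_subset))
      ⟨x, Finset.mem_union_left _ hx⟩ (fun h => by
        have := hAS hx'A
        rw [← h, Finset.mem_union] at this
        rcases this with h1 | h1
        · exact hx'B h1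
        · exact (Finset.mem_sdiff.1 (hD h1)).2 hx'A)
    obtain ⟨e, he, hec⟩ := exists_crosses_of_cut_pos hpos
    have heS := hends e he
    induction e with | _ a b =>
    rw [crosses_mk] at hec
    simp only [Finset.mem_union] at hec
    have hnD : ∀ z ∈ A, z ∉ D := fun z hz h => (Finset.mem_sdiff.1 (hD h)).2 hz
    have hnB : ∀ z, z ∉ A → z ∉ B := fun z hz h => hz (hBA h)
    have haS := heS a (by simp)
    have hbS := heS b (by simp)
    by_cases haA : a ∈ A <;> by_cases hbA : b ∈ A
    · have h1 : s(a, b) ∈ inside (s(x, y) ::ₘ s(x', y') ::ₘ L) A :=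
        mem_inside.2 ⟨he, by simp [haA, hbA]⟩
      have h2 : ¬Crosses B s(a, b) := fun h => h0 (cut_pos h1 h)
      rw [crosses_mk] at h2
      have := hnD a haA
      have := hnD b hbA
      tauto
    · rcases Multiset.mem_cons.1 he with he | he
      · rcases Sym2.eq_iff.1 he with ⟨rfl, rfl⟩ | ⟨rfl, rfl⟩
        · tauto
        · exact hy haA
      · rcases Multiset.mem_cons.1 he with he | he
        · rcases Sym2.eq_iff.1 he with ⟨rfl, rfl⟩ | ⟨rfl, rfl⟩
          · have := hnD a haA
            have := hnB b hbA
            tauto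
          · exact hy' haA
        · exact absurd hL (cut_pos he ⟨a, b, haA, hbA, rfl⟩).ne'
    · rcases Multiset.mem_cons.1 he with he | he
      · rcases Sym2.eq_iff.1 he with ⟨rfl, rfl⟩ | ⟨rfl, rfl⟩
        · exact hy hbA
        · tauto
      · rcases Multiset.mem_cons.1 he with he | he
        · rcases Sym2.eq_iff.1 he with ⟨rfl, rfl⟩ | ⟨rfl, rfl⟩
          · exact hy' hbA
          · have := hnD b hbA
            have := hnB a haA
            tauto
        · exact absurd hL (cut_pos he ⟨b, a, hbA, haA, Sym2.eq_swap⟩).ne'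
    · have h1 : s(a, b) ∈ inside (s(x, y) ::ₘ s(x', y') ::ₘ L) (S \ A) :=
        mem_inside.2 ⟨he, by simp [haA, hbA, haS, hbS]⟩
      have h2 : ¬Crosses D s(a, b) := fun h => (cut_pos h1 h).ne' hD0
      rw [crosses_mk] at h2
      have := hnB a haA
      have := hnB b hbA
      tauto
  have h0'' : cut (inside (s(x, y) ::ₘ s(x', y') ::ₘ L) (S \ A)) C = 0 := by omega
  obtain ⟨z, hz, u, hu, z', hz', u', hu', L', hL'⟩ :=
    hK.exists_pair_of_cut_inside Finset.sdiff_subset hCA hC hCne h0''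
  have hz1 := hmem z u (hCA hz) hu (hL' ▸ by simp)
  have hz2 := hmem z' u' (Finset.mem_sdiff.1 hz').1 hu' (hL' ▸ by simp)
  have hz'C := (Finset.mem_sdiff.1 hz').2
  by_cases hyC : y ∈ C
  · refine hfinal C hCA h0'' hyC ?_
    rcases hz2 with rfl | rfl
    · exact absurd hyC hz'C
    · exact hz'C
  · have hy'C : y' ∈ C := by
      rcases hz1 with rfl | rfl
      · exact absurd hz hyC
      · exact hz
    have hyS : y ∈ S := hends s(x, y) (by simp) y (by simp)
    exact hfinal ((S \ A) \ C) Finset.sdiff_subset (by rw [cut_inside_sdiff, h0''])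
      (by simp [hyS, hy, hyC]) (by simp [hy'C])

/-- Lifting the two edges of a connected spanning subgraph at a vertex of degree two keeps the
other vertices connected. -/
theorem Connects.lift {v x y : V} {L : Multiset (Sym2 V)}
    (hK : Connects S (s(v, x) ::ₘ s(v, y) ::ₘ L))
    (hends : ∀ e ∈ s(v, x) ::ₘ s(v, y) ::ₘ L, ∀ v ∈ e, v ∈ S) (hL : cut L {v} = 0) :
    Connects (S \ {v}) (inside (s(x, y) ::ₘ L) (S \ {v})) := by
  intro C hC hne hCS
  simp only [Multiset.forall_mem_cons, Sym2.ball] at hends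
  obtain ⟨⟨hvS, hxS⟩, ⟨-, hyS⟩, hends⟩ := hends
  have hvC : v ∉ C := fun h => by simpa using hC h
  have hCS' : C ⊆ S := hC.trans Finset.sdiff_subset
  have hLcut : ∀ e ∈ L, ¬Crosses {v} e := fun e he hc => (cut_pos he hc).ne' hL
  have h1 := hK C hCS' hne (fun h => hvC (h ▸ hvS))
  have h2 := hK (insert v C) (Finset.insert_subset hvS hCS') (by simp) (fun h => hCS (by
    rw [← h, Finset.sdiff_singleton_eq_erase, Finset.erase_insert hvC]))
  have h3 : cut L (insert v C) = cut L C := by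
    classical
    refine Multiset.countP_congr rfl fun e he => ?_
    have h4 := hLcut e he
    induction e with | _ a b =>
    simp only [crosses_mk, Finset.mem_singleton, Finset.mem_insert] at h4 ⊢
    by_cases ha : a = v <;> by_cases hb : b = v <;> simp_all
  simp only [cut_cons, h3, Finset.mem_insert, hvC, true_or, true_iff, false_iff] at h1 h2
  have hmem : ∀ z ∈ C, ∀ u, u ∉ C → u ∈ S → s(z, u) ∈ s(x, y) ::ₘ L → u ≠ v →
      0 < cut (inside (s(x, y) ::ₘ L) (S \ {v})) C := by
    intro z hz u hu huS he huv
    refine cut_pos (mem_inside.2 ⟨he, ?_⟩) ⟨z, u, hz, hu, rfl⟩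
    simp only [Sym2.ball]
    exact ⟨hC hz, by simp [huS, huv]⟩
  rcases Nat.eq_zero_or_pos (cut L C) with h5 | h5
  · rw [h5] at h1 h2
    by_cases hxC : x ∈ C <;> by_cases hyC : y ∈ C <;> by_cases hxv : x = v <;>
      by_cases hyv : y = v <;> simp_all
    · exact hmem x hxC y hyC hyS (by simp) hyv
    · exact hmem y hyC x hxC hxS (by simp) hxv
  · obtain ⟨e, he, z, u, hz, hu, rfl⟩ := exists_crosses_of_cut_pos h5
    refine hmem z hz u hu (hends _ he u (by simp)) (by simp [he]) ?_
    rintro rfl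
    refine hLcut _ he ⟨u, z, by simp, ?_, Sym2.eq_swap⟩
    rw [Finset.mem_singleton]
    rintro rfl
    exact hu hz

/-- Every edge-disjoint union of four connected spanning subgraphs with vertex set of size less
than `n` is solvable. -/
def PackingSolvableBelow (V : Type*) [DecidableEq V] (n : ℕ) : Prop :=
  ∀ (S : Finset V) (K : Fin 4 → Multiset (Sym2 V)) (h : V → ZMod 6), S.card < n →
    (∀ e ∈ ∑ i, K i, ∀ v ∈ e, v ∈ S) → (∀ i, Connects S (K i)) →
    (∀ v ∈ S, parity (h v) = cut (∑ i, K i) {v}) → ∑ v ∈ S, h v = 0 → Solvable S (∑ i, K i) h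

theorem mem_sum_of_mem {V : Type*} {K : Fin 4 → Multiset (Sym2 V)} {i : Fin 4} {e : Sym2 V} (he : e ∈ K i) :
    e ∈ ∑ i, K i :=
  Multiset.mem_sum.2 ⟨i, Finset.mem_univ i, he⟩

theorem solvable_of_restrict_packing {K : Fin 4 → Multiset (Sym2 V)}
    (hends : ∀ e ∈ ∑ i, K i, ∀ v ∈ e, v ∈ S)
    (hpar : ∀ v ∈ S, parity (h v) = cut (∑ i, K i) {v}) (hsum : ∑ v ∈ S, h v = 0)
    (ih : PackingSolvableBelow V S.card) (hAS : A ⊆ S) (hA : A ≠ S)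
    (hconn : ∀ i, Connects A (inside (K i) A)) {f : V → ZMod 6}
    (hf : f ∈ reach (notInside (∑ i, K i) A)) (hfh : ∀ v ∈ S, v ∉ A → f v = h v) :
    Solvable S (∑ i, K i) h := by
  refine Solvable.of_restrict hf hfh ?_
  rw [inside_sum]
  refine ih A (fun i => inside (K i) A) (h - f)
    (Finset.card_lt_card (hAS.ssubset_of_ne hA)) ?_ hconn ?_ ?_
  · rw [← inside_sum]
    exact fun e he => (mem_inside.1 he).2
  · rw [← inside_sum]
    exact fun v hv => parity_restrict hAS hpar hf v hv
  · exact sum_restrict_eq_zero hends hAS hsum hf hfh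

theorem solvable_of_contract_packing [Fintype V] {K : Fin 4 → Multiset (Sym2 V)}
    (hends : ∀ e ∈ ∑ i, K i, ∀ v ∈ e, v ∈ S)
    (hpar : ∀ v ∈ S, parity (h v) = cut (∑ i, K i) {v}) (hsum : ∑ v ∈ S, h v = 0)
    (ih : PackingSolvableBelow V S.card) (hK : ∀ i, Connects S (K i)) (hAS : A ⊆ S)
    (hA : A ≠ S) (hA2 : 2 ≤ A.card) (hconn : ∀ i, Connects A (inside (K i) A)) :
    Solvable S (∑ i, K i) h := by
  obtain ⟨a, ha⟩ : A.Nonempty := Finset.card_pos.1 (by omega)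
  obtain ⟨p, hp⟩ : ∃ p, p = contraction A a := ⟨_, rfl⟩
  obtain ⟨f, hf, hfh⟩ := exists_reach_of_contraction (S := S) (H := ∑ i, K i) (h := h) ha (by
    rw [← hp]
    have hm : (∑ i, K i).map (Sym2.map p) = ∑ i, (K i).map (Sym2.map p) := by
      simp only [Fin.sum_univ_four, Multiset.map_add]
    have hlt := card_image_contraction_lt (a := a) hAS hA2
    rw [← hp] at hlt
    rw [hm]
    refine ih (S.image p) (fun i => (K i).map (Sym2.map p)) _ hlt ?_ (fun i => ?_) ?_ ?_
    · rw [← hm]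
      exact ends_contraction hends
    · exact (hK i).contraction fun e he => hends e (mem_sum_of_mem he)
    · rw [← hm]
      exact fun v _ => parity_contraction hends hpar v
    · rw [sum_contraction, Finset.filter_true_of_mem fun u hu => Finset.mem_image_of_mem p hu,
        hsum])
  exact solvable_of_restrict_packing hends hpar hsum ih hAS hA hconn hf hfh

/-- If class `i₀` becomes disconnected without `v`, then it has exactly two edges at `v`, and
lifting them repairs this. The other three classes lose only a leaf. -/
theorem solvable_of_lift_packing {K : Fin 4 → Multiset (Sym2 V)}
    (hends : ∀ e ∈ ∑ i, K i, ∀ v ∈ e, v ∈ S)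
    (hpar : ∀ v ∈ S, parity (h v) = cut (∑ i, K i) {v}) (hsum : ∑ v ∈ S, h v = 0)
    (ih : PackingSolvableBelow V S.card) (hK : ∀ i, Connects S (K i)) {v : V} (hv : v ∈ S)
    {i₀ : Fin 4} (h1 : ∀ i, i ≠ i₀ → cut (K i) {v} = 1)
    (h2 : cut (K i₀) {v} ≤ 2)
    (hn : ¬Connects (S \ {v}) (inside (K i₀) (S \ {v}))) : Solvable S (∑ i, K i) h := by
  simp only [Connects, not_forall] at hn
  obtain ⟨B, hBA, hB, hBne, h0⟩ := hn
  have hendsi : ∀ i, ∀ e ∈ K i, ∀ v ∈ e, v ∈ S := fun i e he => hends e (mem_sum_of_mem he)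
  obtain ⟨x, hx, z, hz, y, hy, z', hz', L, hL⟩ :=
    (hK i₀).exists_pair_of_cut_inside Finset.sdiff_subset hBA hB hBne (by omega)
  have hzS : z ∈ S := hendsi i₀ s(x, z) (by simp [hL]) z (by simp)
  have hzS' : z' ∈ S := hendsi i₀ s(y, z') (by simp [hL]) z' (by simp)
  have hzv : z = v := by simpa [hzS] using hz
  have hzv' : z' = v := by simpa [hzS'] using hz'
  subst hzv
  rw [hzv', Sym2.eq_swap, Sym2.eq_swap (a := y)] at hL
  have hxS := Finset.mem_sdiff.1 (hBA hx)
  have hyS := Finset.mem_sdiff.1 (Finset.mem_sdiff.1 hy).1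
  rw [Finset.mem_singleton] at hxS hyS
  have hL0 : cut L {z} = 0 := by
    rw [hL] at h2
    simp only [cut_cons, Finset.mem_singleton, hxS.2, hyS.2, iff_false, not_true, if_false] at h2
    omega
  obtain ⟨M, hM⟩ : ∃ M, M = L + ∑ i ∈ Finset.univ.erase i₀, K i := ⟨_, rfl⟩
  have hsumK : ∑ i, K i = s(z, x) ::ₘ s(z, y) ::ₘ M := by
    rw [← Finset.add_sum_erase _ K (Finset.mem_univ i₀), hL, hM, Multiset.cons_add,
      Multiset.cons_add]
  obtain ⟨K', hK'⟩ : ∃ K', K' = Function.update K i₀ (s(x, y) ::ₘ L) := ⟨_, rfl⟩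
  have hsumK' : ∑ i, K' i = s(x, y) ::ₘ M := by
    rw [hK', Finset.sum_update_of_mem (Finset.mem_univ i₀), hM, Multiset.cons_add,
      Finset.sdiff_singleton_eq_erase]
  have hpar' : ∀ u ∈ S, parity (h u) = cut (∑ i, K' i) {u} := by
    intro u hu
    obtain ⟨k, _, h3⟩ := exists_cut_lift (v := z) (x := x) (y := y) (K := M) {u}
    rw [hpar u hu, hsumK, hsumK', h3, Nat.cast_add, Nat.cast_mul,
      show ((2 : ℕ) : ZMod 2) = 0 from rfl, zero_mul, add_zero]
  have hends' : ∀ e ∈ ∑ i, K' i, ∀ v ∈ e, v ∈ S := by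
    rw [hsumK] at hends
    rw [hsumK']
    simp only [Multiset.forall_mem_cons, Sym2.ball] at hends ⊢
    exact ⟨⟨hends.1.2, hends.2.1.2⟩, hends.2.2⟩
  have hcut : 2 ≤ cut (∑ i, K' i) {z} := by
    rw [hsumK', hM, ← Multiset.cons_add, cut_add]
    have h3 : cut (∑ i ∈ Finset.univ.erase i₀, K i) {z} = ∑ i ∈ Finset.univ.erase i₀, cut (K i) {z} :=
      map_sum (⟨⟨fun K => cut K {z}, cut_zero _⟩, fun K L => cut_add K L _⟩ :
        Multiset (Sym2 V) →+ ℕ) K _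
    rw [h3, Finset.sum_congr rfl fun i hi => h1 i (Finset.ne_of_mem_erase hi)]
    simp
  have hcut' : cut (∑ i, K' i) {z} = cut (notInside (∑ i, K' i) (S \ {z})) {z} := by
    rw [cut_inside_add _ (S \ {z}), cut_inside_eq_zero, zero_add]
    intro u hu
    exact (Finset.mem_sdiff.1 hu).2
  -- After the lift each of the other three classes still has an edge at `z`; two would suffice to
  -- attain any demand of the right parity. These edges are oriented first and the induction handles
  -- the rest.
  obtain ⟨f, hf, hfz⟩ := exists_reach_apply_eq (notInside (∑ i, K' i) (S \ {z})) z (h z)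
    (by rw [← hcut', hpar' z hv]) (Or.inr (hcut' ▸ hcut))
  obtain ⟨g, hg, hgh⟩ : Solvable S (∑ i, K' i) h := by
    refine solvable_of_restrict_packing hends' hpar' hsum ih (A := S \ {z}) Finset.sdiff_subset
      (by simpa using hv) (fun i => ?_) hf (fun u hu huz => ?_)
    · rcases eq_or_ne i i₀ with rfl | hi
      · rw [hK', Function.update_self]
        have h3 := hK i
        have h4 := hendsi i
        rw [hL] at h3 h4
        exact h3.lift h4 hL0
      · rw [hK', Function.update_of_ne hi]
        refine (hK i).inside_of_cut_le_one Finset.sdiff_subset ?_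
        rw [cut_sdiff (hendsi i), h1 i hi]
    · have : u = z := by simpa [hu] using huz
      rw [this, hfz]
  refine ⟨g, ?_, hgh⟩
  rw [hsumK]
  rw [hsumK'] at hg
  exact reach_lift hg

/-- Six edges suffice for the bound 4 plus norm, which is at most 7: when the norm is 3 the cut is
odd, hence at least 7. -/
theorem solvable_of_six_le_cut [Fintype V] (hends : ∀ e ∈ H, ∀ v ∈ e, v ∈ S)
    (hpar : ∀ v ∈ S, parity (h v) = cut H {v}) (hsum : ∑ v ∈ S, h v = 0) (hS : S.Nonempty)
    (hcut : ∀ A ⊆ S, A.Nonempty → A ≠ S → 6 ≤ cut H A) : Solvable S H h := by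
  obtain ⟨v₀, -⟩ := hS
  refine Admissible.solvable (s := 0) (w := 0) (v₀ := v₀) ⟨hends, hpar, hsum, ?_, ?_, ?_, ?_⟩
  · simp [norm6_zero]
  · simp
  · simp
  · intro A hA hne hAS
    right
    have h1 := hcut A hA hne hAS
    have h2 : parity (∑ v ∈ A, h v) = cut H A := by
      rw [parity_cut, map_sum]
      exact Finset.sum_congr rfl fun v hv => hpar v (hA hv)
    obtain ⟨k, hk⟩ := even_norm6_add h2
    have h3 := norm6_le_three (∑ v ∈ A, h v)
    simp only [Pi.zero_apply, add_zero, Finset.sum_const_zero]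
    omega

/-- The edge-disjoint union of four connected spanning subgraphs has an orientation with every
prescribed boundary. -/
theorem solvable_of_packing [Fintype V] (S : Finset V) (K : Fin 4 → Multiset (Sym2 V))
    (h : V → ZMod 6) (hends : ∀ e ∈ ∑ i, K i, ∀ v ∈ e, v ∈ S) (hK : ∀ i, Connects S (K i))
    (hpar : ∀ v ∈ S, parity (h v) = cut (∑ i, K i) {v}) (hsum : ∑ v ∈ S, h v = 0) :
    Solvable S (∑ i, K i) h := by
  induction hn : S.card using Nat.strong_induction_on generalizing S K h with
  | _ n ih =>
  subst hn
  replace ih : PackingSolvableBelow V S.card :=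
    fun S' K' h' hlt hends' hK' hpar' hsum' => ih _ hlt S' K' h' hends' hK' hpar' hsum' rfl
  rcases Nat.lt_or_ge S.card 2 with hS1 | hS2
  · exact solvable_of_card_le_one hends hsum (by omega)
  rcases Nat.lt_or_ge S.card 3 with hS2' | hS3
  · obtain ⟨x, y, hxy, rfl⟩ := Finset.card_eq_two.1 (show S.card = 2 by omega)
    refine solvable_pair hxy hends hsum (hpar x (by simp)) (Or.inr ?_)
    have : ∀ i, 0 < cut (K i) {x} := fun i => hK i {x} (by simp) (by simp) (fun h => by
      have := congrArg Finset.card h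
      rw [Finset.card_pair hxy] at this
      simp at this)
    have h0 := this 0
    have h1 := this 1
    rw [cut_sum, Fin.sum_univ_four]
    omega
  by_contra hns
  have hcontract : ∀ A ⊆ S, A ≠ S → (∀ i, Connects A (inside (K i) A)) → A.card < 2 := by
    intro A hAS hA hconn
    by_contra h2
    exact hns (solvable_of_contract_packing hends hpar hsum ih hK hAS hA (by omega) hconn)
  refine hns (solvable_of_six_le_cut hends hpar hsum (Finset.card_pos.1 (by omega))
    fun A hAS hne hA => ?_)
  by_contra hlt
  have hendsi : ∀ i, ∀ e ∈ K i, ∀ v ∈ e, v ∈ S := fun i e he => hends e (mem_sum_of_mem he)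
  -- At most five edges are shared by four classes with at least one each.
  obtain ⟨i₀, hi, hi₀⟩ : ∃ i₀, (∀ i, i ≠ i₀ → cut (K i) A = 1) ∧ cut (K i₀) A ≤ 2 := by
    rw [cut_sum, Fin.sum_univ_four] at hlt
    have h0 := hK 0 A hAS hne hA
    have h1 := hK 1 A hAS hne hA
    have h2 := hK 2 A hAS hne hA
    have h3 := hK 3 A hAS hne hA
    by_cases h0' : cut (K 0) A = 1
    · by_cases h1' : cut (K 1) A = 1
      · by_cases h2' : cut (K 2) A = 1
        · exact ⟨3, by intro i hi; fin_cases i <;> first | assumption | exact absurd rfl hi, by omega⟩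
        · exact ⟨2, by intro i hi; fin_cases i <;> first | exact absurd rfl hi | (simp; omega), by omega⟩
      · exact ⟨1, by intro i hi; fin_cases i <;> first | exact absurd rfl hi | (simp; omega), by omega⟩
    · exact ⟨0, by intro i hi; fin_cases i <;> first | exact absurd rfl hi | (simp; omega), by omega⟩
  have hside : ∀ A' ⊆ S, (∀ i, i ≠ i₀ → cut (K i) A' = 1) →
      Connects A' (inside (K i₀) A') → ∀ i, Connects A' (inside (K i) A') := by
    intro A' hA' h1 h2 i
    rcases eq_or_ne i i₀ with rfl | hne
    · exact h2
    · exact (hK i).inside_of_cut_le_one hA' (h1 i hne).le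
  have hcutc : ∀ i, cut (K i) (S \ A) = cut (K i) A := fun i => cut_sdiff (hendsi i)
  -- A side connected in all classes is a single vertex, as otherwise it could be contracted. Its
  -- complement has at least two vertices, so it is not connected in class `i₀`, and lifting
  -- applies.
  have hsmall : ∀ A' ⊆ S, A'.Nonempty → A' ≠ S → cut (K i₀) A' ≤ 2 →
      (∀ i, i ≠ i₀ → cut (K i) A' = 1) → ¬Connects A' (inside (K i₀) A') := by
    intro A' hA' hne' hA'S h2 h1 hc
    have h3 := hcontract A' hA' hA'S (hside A' hA' h1 hc)
    obtain ⟨v, rfl⟩ := Finset.card_eq_one.1 (show A'.card = 1 by have := hne'.card_pos; omega)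
    have hv : v ∈ S := by simpa using hA'
    refine hns (solvable_of_lift_packing hends hpar hsum ih hK hv h1 h2 fun hc' => ?_)
    have hcv : ∀ i, cut (K i) (S \ {v}) = cut (K i) {v} := fun i => cut_sdiff (hendsi i)
    have h4 := hcontract (S \ {v}) Finset.sdiff_subset (by simpa using hv)
      (hside _ Finset.sdiff_subset (fun i hi => by rw [hcv, h1 i hi]) hc')
    rw [Finset.card_sdiff_of_subset hA', Finset.card_singleton] at h4
    omega
  rcases (hK i₀).inside_or_inside (hendsi i₀) hAS hi₀ with hc | hc
  · exact hsmall A hAS hne hA hi₀ hi hc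
  · refine hsmall (S \ A) Finset.sdiff_subset (Finset.sdiff_nonempty.2 fun h => hA (hAS.antisymm h))
      (fun h => ?_) (by rwa [hcutc]) (fun i h => by rw [hcutc, hi i h]) hc
    obtain ⟨a, ha⟩ := hne
    have := hAS ha
    rw [← h] at this
    exact (Finset.mem_sdiff.1 this).2 ha

end EdgeMultiset

namespace EdgeMultiset

open scoped Pointwise

/-! ### Integer flows, signs and lifting residues -/

/-- A modular `3`-flow with all values one can be lifted to an integer flow with values `1`, `-2`. -/
theorem exists_integer_flow {E V : Type*} [Fintype E] [Fintype V] [DecidableEq V] (t r : E → V)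
    (h : ∀ v, ((∑ e, if t e = v then 1 else 0) - ∑ e, if r e = v then 1 else 0 : ZMod 3) = 0) :
    ∃ f : E → ℤ, (∀ e, f e = 1 ∨ f e = -2) ∧
      ∀ v, (∑ e, if t e = v then f e else 0) - (∑ e, if r e = v then f e else 0) = 0 := by
  classical
  -- Each edge is to be assigned to one of its ends, with `k v` edges assigned to `v`. An edge gets
  -- the value -2 if assigned to its tail and 1 otherwise; the boundary at `v` is then outdegree
  -- plus twice indegree minus `3 * k v`.
  have hk : ∀ v, ∃ k, 3 * k = (Finset.univ.filter (t · = v)).card +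
      2 * (Finset.univ.filter (r · = v)).card := by
    intro v
    have h1 := h v
    simp only [← Finset.natCast_card_filter] at h1
    have h2 : (3 : ℕ) ∣ (Finset.univ.filter (t · = v)).card +
        2 * (Finset.univ.filter (r · = v)).card := by
      rw [← ZMod.natCast_eq_zero_iff, Nat.cast_add, Nat.cast_mul, ← h1, sub_eq_add_neg,
        neg_eq_neg_one_mul]
      rfl
    exact ⟨_, Nat.mul_div_cancel' h2⟩
  choose k hk using hk
  -- Hall's condition, with `k v` slots at `v`: summed over the ends of `F`, `3 * k v` counts each
  -- edge of `F` at least once at its tail and twice at its head.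
  have hall : ∀ F : Finset E, F.card ≤
      (F.biUnion fun e => ({t e, r e} : Finset V).sigma fun v => Finset.range (k v)).card := by
    intro F
    have h1 : (F.biUnion fun e => ({t e, r e} : Finset V)).sigma (fun v => Finset.range (k v)) ⊆
        F.biUnion fun e => ({t e, r e} : Finset V).sigma fun v => Finset.range (k v) := by
      rintro ⟨v, n⟩ hx
      simp only [Finset.mem_sigma, Finset.mem_biUnion] at hx ⊢
      obtain ⟨⟨e, he, hv⟩, hn⟩ := hx
      exact ⟨e, he, hv, hn⟩
    refine le_trans ?_ (Finset.card_le_card h1)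
    rw [Finset.card_sigma]
    simp only [Finset.card_range]
    set U := F.biUnion fun e => ({t e, r e} : Finset V)
    have h2 : F.card = ∑ v ∈ U, (F.filter (t · = v)).card :=
      Finset.card_eq_sum_card_fiberwise fun e he =>
        Finset.mem_biUnion.2 ⟨e, he, by simp⟩
    have h3 : F.card = ∑ v ∈ U, (F.filter (r · = v)).card :=
      Finset.card_eq_sum_card_fiberwise fun e he =>
        Finset.mem_biUnion.2 ⟨e, he, by simp⟩
    have h4 : ∑ v ∈ U, ((F.filter (t · = v)).card + 2 * (F.filter (r · = v)).card) ≤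
        ∑ v ∈ U, 3 * k v := by
      refine Finset.sum_le_sum fun v _ => ?_
      rw [hk]
      have h5 := Finset.card_le_card (Finset.filter_subset_filter (t · = v) (Finset.subset_univ F))
      have h6 := Finset.card_le_card (Finset.filter_subset_filter (r · = v) (Finset.subset_univ F))
      omega
    rw [Finset.sum_add_distrib, ← Finset.mul_sum, ← Finset.mul_sum, ← h2, ← h3] at h4
    omega
  obtain ⟨φ, hφ, hmem⟩ := (Finset.all_card_le_biUnion_card_iff_exists_injective _).1 hall
  simp only [Finset.mem_sigma, Finset.mem_insert, Finset.mem_singleton, Finset.mem_range] at hmem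
  have hle : ∀ v, (Finset.univ.filter fun e => (φ e).1 = v).card ≤ k v := by
    intro v
    rw [← Finset.card_range (k v)]
    refine Finset.card_le_card_of_injOn (fun e => (φ e).2) (fun e he => ?_) fun e he e' he' hee => ?_
    · have := (hmem e).2
      rw [(Finset.mem_filter.1 he).2] at this
      simpa using this
    · have h1 := (Finset.mem_filter.1 he).2
      have h2 := (Finset.mem_filter.1 he').2
      exact hφ (Sigma.ext (h1.trans h2.symm) (heq_of_eq hee))
  have hsum : ∑ v, (Finset.univ.filter fun e => (φ e).1 = v).card = ∑ v, k v := by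
    have h1 : ∀ c : E → V, ∑ v, (Finset.univ.filter (c · = v)).card = Fintype.card E := fun c =>
      (Finset.card_eq_sum_card_fiberwise (s := Finset.univ) fun e _ => Finset.mem_univ (c e)).symm
    have h2 : 3 * ∑ v, k v = 3 * Fintype.card E := by
      rw [Finset.mul_sum, Finset.sum_congr rfl fun v _ => hk v, Finset.sum_add_distrib,
        ← Finset.mul_sum, h1, h1]
      ring
    rw [h1]
    omega
  have heq : ∀ v, (Finset.univ.filter fun e => (φ e).1 = v).card = k v := fun v =>
    (Finset.sum_eq_sum_iff_of_le fun v _ => hle v).1 hsum v (Finset.mem_univ v)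
  refine ⟨fun e => if (φ e).1 = t e then -2 else 1, fun e => by dsimp only; split_ifs <;> simp,
    fun v => ?_⟩
  have h1 : (3 * k v : ℤ) = (∑ e, if t e = v then 1 else 0) + 2 * ∑ e, if r e = v then 1 else 0 := by
    have := hk v
    zify at this
    rw [this, Finset.natCast_card_filter, Finset.natCast_card_filter]
  rw [← heq v, Finset.natCast_card_filter] at h1
  rw [← sub_eq_zero] at h1
  refine neg_eq_zero.1 (Eq.trans ?_ h1)
  simp only [Finset.mul_sum, ← Finset.sum_sub_distrib, ← Finset.sum_add_distrib,
    ← Finset.sum_neg_distrib]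
  refine Finset.sum_congr rfl fun e _ => ?_
  by_cases he : (φ e).1 = t e
  · simp only [he, if_true]
    split_ifs <;> norm_num
  · simp only [(hmem e).1.resolve_left he]
    have : r e ≠ t e := fun h => he ((hmem e).1.resolve_left he ▸ h)
    simp only [this, if_false]
    split_ifs <;> norm_num

/-- An element of the reach of a family of edges comes from a choice of signs. -/
theorem exists_signs {E V : Type*} [Fintype E] [DecidableEq V] (t r : E → V) {f : V → ZMod 6}
    (hf : f ∈ reach (∑ e, ({s(t e, r e)} : Multiset (Sym2 V)))) :
    ∃ σ : E → ℤ, (∀ e, σ e = 1 ∨ σ e = -1) ∧ ∀ v, f v =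
      (∑ e, if t e = v then (σ e : ZMod 6) else 0) - ∑ e, if r e = v then (σ e : ZMod 6) else 0 := by
  have h1 : reach (∑ e, ({s(t e, r e)} : Multiset (Sym2 V))) = ∑ e, edgeBoundary s(t e, r e) := by
    simp only [edgeBoundary_eq]
    exact map_sum (⟨⟨reach, reach_zero⟩, reach_add⟩ : Multiset (Sym2 V) →+ Set (V → ZMod 6)) _ _
  rw [h1, Set.mem_finsetSum] at hf
  obtain ⟨g, hg, rfl⟩ := hf
  have h2 : ∀ e, ∃ a : ℤ, (a = 1 ∨ a = -1) ∧
      g e = Pi.single (t e) (a : ZMod 6) - Pi.single (r e) (a : ZMod 6) := by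
    intro e
    rcases mem_edgeBoundary.1 (hg (Finset.mem_univ e)) with h | h
    · exact ⟨1, Or.inl rfl, by simpa using h⟩
    · refine ⟨-1, Or.inr rfl, ?_⟩
      rw [h, Int.cast_neg, Int.cast_one, Pi.single_neg, Pi.single_neg]
      abel
  choose σ hσ hgσ using h2
  refine ⟨σ, hσ, fun v => ?_⟩
  rw [← Finset.sum_sub_distrib, Finset.sum_apply]
  refine Finset.sum_congr rfl fun e _ => ?_
  rw [hgσ, Pi.sub_apply, Pi.single_apply, Pi.single_apply]
  simp only [eq_comm]

/-- Reduction from `ZMod 6` to `ZMod 3`. -/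
def modThree : ZMod 6 →+* ZMod 3 := ZMod.castHom (by norm_num) (ZMod 3)

/-- A zero-sum function modulo three lifts to one modulo six with the parities of the degrees. -/
theorem exists_lift_mod_six {V : Type*} [Fintype V] (H : Multiset (Sym2 V)) (b : V → ZMod 3)
    (hb : ∑ v, b v = 0) : ∃ h : V → ZMod 6, (∀ v, modThree (h v) = b v) ∧
      (∀ v, parity (h v) = cut H {v}) ∧ ∑ v, h v = 0 := by
  -- Chinese remainders: 4 is 1 modulo 3 and 0 modulo 2, while 3 is 0 modulo 3 and 1 modulo 2.
  refine ⟨fun v => ((4 * (b v).val + 3 * cut H {v} : ℕ) : ZMod 6), fun v => ?_, fun v => ?_, ?_⟩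
  · rw [map_natCast, Nat.cast_add, Nat.cast_mul, Nat.cast_mul, ZMod.natCast_zmod_val,
      show ((3 : ℕ) : ZMod 3) = 0 from rfl, show ((4 : ℕ) : ZMod 3) = 1 from rfl]
    ring
  · rw [map_natCast, Nat.cast_add, Nat.cast_mul, Nat.cast_mul,
      show ((3 : ℕ) : ZMod 2) = 1 from rfl, show ((4 : ℕ) : ZMod 2) = 0 from rfl]
    ring
  · rw [← Nat.cast_sum, Finset.sum_add_distrib, ← Finset.mul_sum, ← Finset.mul_sum]
    have h1 : 3 ∣ ∑ v, (b v).val := by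
      rw [← ZMod.natCast_eq_zero_iff, Nat.cast_sum, ← hb]
      exact Finset.sum_congr rfl fun v _ => ZMod.natCast_zmod_val _
    have h2 : 2 ∣ ∑ v, cut H {v} := by
      rw [← ZMod.natCast_eq_zero_iff, Nat.cast_sum, ← parity_cut,
        cut_self fun e _ v _ => Finset.mem_univ v, Nat.cast_zero]
    rw [ZMod.natCast_eq_zero_iff]
    omega

end EdgeMultiset

namespace Graph

open EdgeMultiset

/-! ### Return to graphs -/

variable {α β : Type*} {G : Graph α β}

theorem Orientation.boundary_eq_sum [Fintype E(G)] [DecidableEq V(G)] {A : Type*} [AddCommGroup A]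
    (D : G.Orientation) (f : E(G) → A) (v : V(G)) : D.boundary f v =
      (∑ e, if D.tail e = v then f e else 0) - ∑ e, if D.head e = v then f e else 0 := by
  simp only [Orientation.boundary, finsum_eq_sum_of_fintype, finsum_eq_if]

theorem IsConnected.exists_isLink {T : Graph α β} (hT : T.IsConnected) {A : Set α} {x y : α}
    (hx : x ∈ V(T)) (hy : y ∈ V(T)) (hxA : x ∈ A) (hyA : y ∉ A) :
    ∃ e u v, u ∈ A ∧ v ∉ A ∧ T.IsLink e u v := by
  by_contra! hcon
  refine hyA (Relation.ReflTransGen.rec (motive := fun z _ => z ∈ A) hxA ?_ (hT.2 x hx y hy))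
  rintro u v - ⟨e, he⟩ hu
  by_contra hv
  exact hcon e u v hu hv he

/-- The edges of a graph with `4` edge-disjoint spanning trees fall into four connected spanning
classes. -/
theorem HasEdgeDisjointSpanningTrees.exists_packing [Fintype V(G)] [Fintype E(G)]
    (hT : G.HasEdgeDisjointSpanningTrees 4) (D : G.Orientation) :
    ∃ K : Fin 4 → Multiset (Sym2 V(G)), (∀ i, Connects Finset.univ (K i)) ∧
      ∑ i, K i = ∑ e, {s(D.tail e, D.head e)} := by
  classical
  obtain ⟨T, hT, hdisj⟩ := hT
  have hc : ∃ c : E(G) → Fin 4, ∀ e i, e.1 ∈ E(T i) → c e = i := by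
    -- Edges in none of the trees are put into class 0; extra edges do not harm connectedness.
    refine ⟨fun e => if h : ∃ i, e.1 ∈ E(T i) then h.choose else 0, fun e i hi => ?_⟩
    have h : ∃ i, e.1 ∈ E(T i) := ⟨i, hi⟩
    simp only [dif_pos h]
    by_contra hne
    exact Set.disjoint_left.1 (hdisj _ _ hne) h.choose_spec hi
  obtain ⟨c, hc⟩ := hc
  refine ⟨fun i => ∑ e with c e = i, {s(D.tail e, D.head e)}, fun i A _ hne hA => ?_,
    Finset.sum_fiberwise _ _ _⟩
  obtain ⟨x, hx⟩ := hne
  obtain ⟨y, hy⟩ : ∃ y, y ∉ A := by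
    by_contra! h
    exact hA (Finset.eq_univ_iff_forall.2 h)
  obtain ⟨hsub, htree⟩ := hT i
  have hV := hsub.vertexSet_eq
  obtain ⟨e, u, v, hu, hv, he⟩ := htree.1.exists_isLink (A := {z | ∃ a ∈ A, a.1 = z})
    (by rw [hV]; exact x.2) (by rw [hV]; exact y.2) ⟨x, hx, rfl⟩ (by
      rintro ⟨a, ha, hay⟩
      rw [Subtype.ext hay] at ha
      exact hy ha)
  have heG : G.IsLink e u v := hsub.le.isLink_mono he
  obtain ⟨a, ha, rfl⟩ := hu
  have hvA : (⟨v, heG.right_mem⟩ : V(G)) ∉ A := fun h => hv ⟨_, h, rfl⟩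
  refine cut_pos (e := s(a, ⟨v, heG.right_mem⟩)) ?_ ⟨a, _, ha, hvA, rfl⟩
  refine Multiset.mem_sum.2 ⟨⟨e, heG.edge_mem⟩, by simpa using hc ⟨e, heG.edge_mem⟩ i he.edge_mem, ?_⟩
  rw [Multiset.mem_singleton, Sym2.eq_iff]
  refine (heG.eq_and_eq_or_eq_and_eq (D.isLink ⟨e, heG.edge_mem⟩)).imp ?_ ?_
  · rintro ⟨h1, h2⟩
    exact ⟨Subtype.ext h1, Subtype.ext h2⟩
  · rintro ⟨h1, h2⟩
    exact ⟨Subtype.ext h1, Subtype.ext h2⟩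

theorem HasEdgeDisjointSpanningTrees.isGroupConnected [Finite V(G)] [Finite E(G)]
    (hT : G.HasEdgeDisjointSpanningTrees 4) : G.IsGroupConnected (ZMod 3) := by
  classical
  intro D b hb
  have := Fintype.ofFinite V(G)
  have := Fintype.ofFinite E(G)
  rw [finsum_eq_sum_of_fintype] at hb
  obtain ⟨K, hK, hsum⟩ := hT.exists_packing D
  obtain ⟨h, h3, h2, h0⟩ := exists_lift_mod_six (∑ i, K i) b hb
  obtain ⟨f, hf, hfh⟩ := solvable_of_packing Finset.univ K h (fun _ _ v _ => Finset.mem_univ v) hK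
    (fun v _ => h2 v) h0
  rw [hsum] at hf
  obtain ⟨σ, hσ, hfσ⟩ := exists_signs D.tail D.head hf
  refine ⟨fun e => (σ e : ZMod 3), fun e => ?_, fun v => ?_⟩
  · dsimp only
    rcases hσ e with h | h <;> rw [h] <;> decide
  · rw [D.boundary_eq_sum, ← h3 v, ← hfh v (Finset.mem_univ v), hfσ v, map_sub, map_sum, map_sum]
    simp only [apply_ite modThree, map_intCast, map_zero]

theorem IsGroupConnected.hasNowhereZeroFlow [Finite V(G)] [Finite E(G)]
    (hG : G.IsGroupConnected (ZMod 3)) : G.HasNowhereZeroFlow 3 := by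
  classical
  have := Fintype.ofFinite V(G)
  have := Fintype.ofFinite E(G)
  obtain ⟨D⟩ := G.nonempty_orientation
  obtain ⟨g, hg, hg0⟩ := hG D 0 (by simp)
  -- Edges of value -1 are reversed, so that all values of the modular flow become 1.
  obtain ⟨D', hD'⟩ : ∃ D' : G.Orientation, ∀ e, (g e = 1 → D'.tail e = D.tail e ∧
      D'.head e = D.head e) ∧ (g e ≠ 1 → D'.tail e = D.head e ∧ D'.head e = D.tail e) := by
    refine ⟨⟨fun e => if g e = 1 then D.tail e else D.head e,
      fun e => if g e = 1 then D.head e else D.tail e, fun e => ?_⟩, fun e =>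
        ⟨fun h => by simp [h], fun h => by simp [h]⟩⟩
    split_ifs
    · exact D.isLink e
    · exact (D.isLink e).symm
  have hval : ∀ a : ZMod 3, a ≠ 0 → a = 1 ∨ a = -1 := by decide
  obtain ⟨f, hf, hf0⟩ := exists_integer_flow D'.tail D'.head (fun v => by
    have h1 := hg0 v
    rw [D.boundary_eq_sum, ← Finset.sum_sub_distrib] at h1
    rw [← Finset.sum_sub_distrib]
    refine (Finset.sum_congr rfl fun e _ => ?_).trans h1
    rcases hval _ (hg e) with h | h
    · rw [((hD' e).1 h).1, ((hD' e).1 h).2, h]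
    · have h' : g e ≠ 1 := by rw [h]; decide
      rw [((hD' e).2 h').1, ((hD' e).2 h').2, h]
      split_ifs <;> ring)
  refine ⟨D', f, fun e => ?_, fun v => ?_⟩
  · rcases hf e with h | h <;> rw [h] <;> norm_num
  · rw [D'.boundary_eq_sum, hf0 v]

end Graph

theorem mainTheorem3 {α β : Type*} (G : Graph α β) [G.Loopless]
    (hV : G.vertexSet.Finite) (hE : G.edgeSet.Finite) (hT : G.HasEdgeDisjointSpanningTrees 4) :
    G.IsGroupConnected (ZMod 3) ∧ G.HasNowhereZeroFlow 3 := by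
  have := hV.to_subtype
  have := hE.to_subtype
  exact ⟨hT.isGroupConnected, hT.isGroupConnected.hasNowhereZeroFlow⟩
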